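/- **Setting.** An instance consists of a finite field $\mathbb F$ with $q=|\mathbb F|$, a finite alphabet $\Gamma$, integers $n\ge 0$ and $d,m\ge 1$ with $dm<q$, a mapping $f$ that assigns to every $x\in\Gamma^n$ an $m$-variate polynomial $f^x$ over $\mathbb F$ of individual degree at most $d$, and $\alpha\in\mathbb F$. Integers $0,1,\dots,q-1$ are identified with the elements of $\mathbb F$, with $0\mapsto 0$; logarithms are to base two. Let $v$ be $q^m(\log m+\log\log q)/32$ rounded to the nearest integer and $p=m(dmq)^3$; assume $p\le (d+1)^m$, so that strings $w\in\mathbb F^p$ have a low-degree extension $\hat w:\mathbb F^m\to\mathbb F$ of individual degree $d$, with $[p]\subseteq\{0,\dots,d\}^m\subseteq\mathbb F^m$ via base-$(d+1)$ digits. Let $\chi_0,\dots,\chi_{dm}$ be the univariate Lagrange polynomials for the nodes $0,1,\dots,dm$. A line $L:\mathbb F\to\mathbb F^m$ is sent as the pair $(L(0),L(1))$. **Protocol zk-pep (prover's side), for $\mathrm{PEP}(f,\alpha)=\{(x,\beta)\in\Gamma^n\times\mathbb F^m: f^x(\beta)=\alpha\}$.** (0) The prover sends $z\in(\mathbb F^m)^v$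 uniformly at random. (1) The input $x$, followed by $\beta$, is streamed. (2) The verifier sends a line $L$. The prover sends $(y,\gamma,k)$ with $y\in\mathbb F^{dm\times p}$ (row by row) and $k\in[p]$ uniformly random and $\gamma_i=f^x(L(i))-y_{ik}$ for $1\le i\le dm$. (3) The verifier sends $\rho\in\mathbb F^m$ and an index $\ell$. The prover checks that $\ell\in[v]$, $z_\ell=\rho$, $L$ is nonconstant, $\rho=L(t)$ for some $t$, and $t\notin\{0,1,\dots,dm\}$. (4) The verifier sends a line $L'$. The prover sends the polynomial $u\mapsto\sum_{i=1}^{dm}\chi_i(t)\,\hat y_i(L'(u))$ as its values at $0,1,\dots,dm$, where $y_i$ is the $i$-th row of $y$. If $L(0)\ne\beta$, if the check in (3) fails, or if $L'(0)\neq k$, the prover aborts and sends all-zero messages from then on. **Adversaries and views.** A streaming algorithm has space $s$ if its memory has at most $2^s$ states. A (possibly malicious) verifier $\widetilde V$ is a streaming algorithm that, with each symbol it reads, consumes fresh uniform randomness from a finite set, and whose messages $L$, $(\rho,\ell)$, $L'$ are functions of its memory state at the respective steps. Its view in an interaction with the honest prover on input $(x,\beta)$ is the stream $(z,x,\beta,y,\gamma,k,\text{last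 message})$, in this order, interleaved with the randomness $r$ that $\widetilde V$ consumes. A simulator is a streaming algorithm that reads $(x,\beta)$ and $r$ once, can toss coins, has query access to a uniformly random string over $\mathbb F$ (whose queries, like all its operations, are determined by its memory state), and outputs a stream of the same kind, in which the input symbols and randomness appear as they are read; it has white-box access to $\widetilde V$, that is, its program may depend arbitrarily on $\widetilde V$ (but not on $x,\beta,r$). A distinguisher is a randomised streaming algorithm that reads a view and accepts or rejects. **Theorem.** For all constants $c_f,c_V$ there is a constant $c_S$ such that the following holds. Consider any sequence of instances with $q\to\infty$ and $dm=o(q)$ such that, for every $\rho\in\mathbb F^m$, $f^x(\rho)$ can be computed by streaming $x$ in space $c_f\,m\log q$. There is a simulator $S$ with white-box access to the verifier such that: * for every verifier $\widetilde V$ of space at most $c_V\,m\log q$, $S(\widetilde V)$ has space at most $c_S\,(d+m\log q)\,m\log q=O(d\,m^2\log^2 q)$; * for all sequences of such verifiers $\widetilde V$, of distinguishers $D$ with space $(dm)^2\operatorname{polylog}(q)$ (that is, at most $a\,(dm)^2\log^e q$ for some constants $a,e$) and of inputs $(x,\beta)\in\mathrm{PEP}(f,\alpha)$, $$\Bigl|\Pr\bigl[D(\mathrm{view}_{P,\widetilde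 V}(x,\beta))\text{ accepts}\bigr]-\Pr\bigl[D(S(\widetilde V,x,\beta))\text{ accepts}\bigr]\Bigr|=o(1).$$ That is, zk-pep is zero-knowledge, secure against distinguishers with space $(dm)^2\operatorname{polylog}(q)$. -/

import Mathlib

open Filter Topology

noncomputable section

namespace ZKPep

/-- An instance of the polynomial evaluation problem together with the parameters of the protocol:
a finite field `F`, an alphabet `Γ`, the input length `n`, the degree `d`, the dimension `m`,
the mapping `x ↦ f^x` into `m`-variate polynomials of individual degree at most `d`, and the
target value `α`. The map `node` is the identification of the integers `0, 1, …, |F| - 1` with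
the elements of `F` (with `0 ↦ 0`). -/
structure PEP where
  F : Type
  [field : Field F]
  [fintypeF : Fintype F]
  Γ : Type
  [fintypeΓ : Fintype Γ]
  n : ℕ
  d : ℕ
  m : ℕ
  node : ℕ → F
  f : (Fin n → Γ) → MvPolynomial (Fin m) F
  α : F
  d_pos : 0 < d
  m_pos : 0 < m
  node_zero : node 0 = 0
  node_inj : Set.InjOn node (Set.Iio (Fintype.card F))
  degree_le : ∀ x j, (f x).degreeOf j ≤ d
  dm_lt : d * m < Fintype.card F
  /-- The commitment length `p = m (d m q)^3` does not exceed the length `(d + 1)^m` of the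
  longest string that has a low-degree extension of degree `d` and dimension `m`. -/
  p_le : m * (d * m * Fintype.card F) ^ 3 ≤ (d + 1) ^ m

attribute [instance] PEP.field PEP.fintypeF PEP.fintypeΓ

namespace PEP

variable (I : PEP)

/-- The field size `q`. -/
def q : ℕ := Fintype.card I.F

/-- `log q`, to base two. -/
def logq : ℝ := Real.logb 2 I.q

/-- Points of the space `F^m`. -/
abbrev Pt : Type := Fin I.m → I.F

/-- The length `v = q^m (log m + log log q) / 32` of the temporal commitment, rounded to the
nearest integer. -/
def v : ℕ := (round ((I.q : ℝ) ^ I.m * (Real.logb 2 I.m + Real.logb 2 I.logq) / 32)).toNat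

/-- The length `p = m (d m q)^3` of the algebraic commitment. -/
def p : ℕ := I.m * (I.d * I.m * I.q) ^ 3

instance : NeZero I.p :=
  ⟨by
    have h1 := I.d_pos
    have h2 := I.m_pos
    have h3 : 0 < I.q := Fintype.card_pos
    unfold p
    positivity⟩

/-- The language of pairs `(x, β)` with `f^x(β) = α`. -/
def language : Set ((Fin I.n → I.Γ) × I.Pt) := {w | MvPolynomial.eval w.2 (I.f w.1) = I.α}

/-- The Lagrange polynomial `χ_i` for the interpolation nodes `0, 1, …, D`, evaluated at `t`. -/
def chi (D i : ℕ) (t : I.F) : I.F :=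
  open scoped Classical in
  (Lagrange.basis (Finset.range (D + 1)) I.node i).eval t

/-- The `j`-th digit of `k` in base `d + 1`. -/
def digit (k : ℕ) (j : Fin I.m) : ℕ := k / (I.d + 1) ^ (j : ℕ) % (I.d + 1)

/-- The identification of a coordinate `k` of a length-`p` string with a point of
`{0, …, d}^m ⊆ F^m`. -/
def coord (k : Fin I.p) : I.Pt := fun j => I.node (I.digit k j)

/-- The low-degree extension of `y ∈ F^p`, of individual degree `d` and dimension `m`. -/
def lde (y : Fin I.p → I.F) (u : I.Pt) : I.F :=
  ∑ k : Fin I.p, y k * ∏ j : Fin I.m, I.chi I.d (I.digit k j) (u j)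

/-- A line `L : F → F^m`, in its canonical form `(L(0), L(1))`. -/
abbrev Line : Type := I.Pt × I.Pt

variable {I} in
/-- The point `L(t)` of a line. -/
def lineAt (L : I.Line) (t : I.F) : I.Pt := fun j => L.1 j + t * (L.2 j - L.1 j)

end PEP

/-! ### Streams -/

/-- The symbols that the prover sends: a symbol of `z` in the setup, then the entries of the
algebraic commitment `(y, γ, k)`, then the evaluations sent in the algebraic decommitment. -/
inductive ProverSymbol (I : PEP) : Type
  | setup (a : I.Pt)
  | entry (a : I.F)
  | correction (a : I.F)
  | index (k : Fin I.p)
  | evaluation (a : I.F)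

/-- The symbols streamed by the verifier: prover symbols and input symbols. The input is `x`
followed by the point `β`. -/
inductive Letter (I : PEP) : Type
  | prover (a : ProverSymbol I)
  | symbol (a : I.Γ)
  | point (b : I.Pt)

/-- The input stream `(x, β)`. -/
def inputStream (I : PEP) (x : Fin I.n → I.Γ) (β : I.Pt) : List (Letter I) :=
  (List.ofFn fun i => Letter.symbol (x i)) ++ [Letter.point β]

/-- A (possibly malicious) streaming verifier. With every symbol of its stream it consumes fresh
randomness, uniform in `Coin`, which it can reread only if it stores it. Its messages are read off
its memory state (snapshot) at the respective steps: the line `L` after the input, the temporal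
decommitment `(ρ, ℓ)` and the line `L'` after the algebraic commitment. -/
structure Verifier (I : PEP) where
  State : Type
  [fintypeState : Fintype State]
  Coin : Type
  [fintypeCoin : Fintype Coin]
  [nonemptyCoin : Nonempty Coin]
  init : State
  step : State → Letter I → Coin → State
  line : State → I.Line
  opening : State → I.Pt × ℕ
  line' : State → I.Line

attribute [instance] Verifier.fintypeState Verifier.fintypeCoin Verifier.nonemptyCoin

/-- The number of bits of memory of the verifier. -/
def Verifier.space {I : PEP} (V : Verifier I) : ℝ := Real.logb 2 (Fintype.card V.State)

/-- The verifier reads a string from state `σ`. The result is the string together with the random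
symbols consumed along the way (this part of the view), and the new memory state. -/
def Verifier.deliver {I : PEP} (V : Verifier I) :
    List (Letter I) → V.State → PMF (List (Letter I × V.Coin) × V.State)
  | [], σ => PMF.pure ([], σ)
  | a :: as, σ =>
      (PMF.uniformOfFintype V.Coin).bind fun c =>
        (V.deliver as (V.step σ a c)).map fun w => ((a, c) :: w.1, w.2)

/-! ### The honest prover -/

/-- The setup message `z ∈ (F^m)^v`. -/
def setupMessage (I : PEP) (z : Fin I.v → I.Pt) : List (Letter I) :=
  List.ofFn fun i => Letter.prover (.setup (z i))

/-- The message `(y, γ, k)`, with the rows of `y ∈ F^{dm × p}` sent one after the other. -/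
def commitMessage (I : PEP) (y : Fin (I.d * I.m) → Fin I.p → I.F)
    (γ : Fin (I.d * I.m) → I.F) (k : Fin I.p) : List (Letter I) :=
  ((List.ofFn fun i => List.ofFn fun j => Letter.prover (.entry (y i j))).flatten
    ++ List.ofFn fun i => Letter.prover (.correction (γ i))) ++ [Letter.prover (.index k)]

/-- The algebraic commitment to the restriction of `f^x` to the line `L` with randomness `(y, k)`:
the correction is `γ_i = f^x(L(i)) - y_{ik}` for `1 ≤ i ≤ dm`. If `L(0) ≠ β`, then the prover
aborts and sends zeroes. -/
def algebraicCommitment (I : PEP) (x : Fin I.n → I.Γ) (β : I.Pt) (L : I.Line)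
    (y : Fin (I.d * I.m) → Fin I.p → I.F) (k : Fin I.p) : List (Letter I) :=
  open scoped Classical in
  if L.1 = β then
    commitMessage I y
      (fun i => MvPolynomial.eval (PEP.lineAt L (I.node (i + 1))) (I.f x) - y i k) k
  else commitMessage I 0 0 0

/-- The final message: a polynomial `F → F` of degree at most `dm`, in the form of its values at
`0, 1, …, dm`. -/
def decommitMessage (I : PEP) (h : I.F → I.F) : List (Letter I) :=
  List.ofFn fun j : Fin (I.d * I.m + 1) => Letter.prover (.evaluation (h (I.node j)))

/-- The prover's check of the temporal decommitment `(ρ, ℓ)`: `z_ℓ = ρ = L(t)` for a nonconstant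
line `L`, where `t = L⁻¹(ρ)` is not among `0, 1, …, dm`. -/
def OpensAt (I : PEP) (z : Fin I.v → I.Pt) (L : I.Line) (o : I.Pt × ℕ) (t : I.F) : Prop :=
  (∃ h : o.2 < I.v, z ⟨o.2, h⟩ = o.1) ∧ L.1 ≠ L.2 ∧ PEP.lineAt L t = o.1 ∧
    ∀ a ≤ I.d * I.m, t ≠ I.node a

/-- The algebraic decommitment: with `t = L⁻¹(ρ)`, the restriction to the line `L'` of the
low-degree extension of `∑ i, χ_i(t) y_i`. If `L(0) ≠ β`, if the temporal decommitment is invalid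
or if `L'(0) ≠ k`, then the prover aborts and sends zeroes. -/
def algebraicDecommitment (I : PEP) (β : I.Pt) (z : Fin I.v → I.Pt) (L : I.Line)
    (y : Fin (I.d * I.m) → Fin I.p → I.F) (k : Fin I.p) (o : I.Pt × ℕ) (L' : I.Line) :
    List (Letter I) :=
  open scoped Classical in
  if h : L.1 = β ∧ L'.1 = I.coord k ∧ ∃ t, OpensAt I z L o t then
    decommitMessage I fun u =>
      ∑ i : Fin (I.d * I.m),
        I.chi (I.d * I.m) (i + 1) h.2.2.choose * I.lde (y i) (PEP.lineAt L' u)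
  else decommitMessage I 0

/-- The view of the verifier `V` in an interaction with the honest prover on input `(x, β)`: the
setup, the input, the algebraic commitment and the algebraic decommitment, in this order, each
symbol together with the randomness that `V` consumes when it reads it. -/
def realView (I : PEP) (V : Verifier I) (x : Fin I.n → I.Γ) (β : I.Pt) :
    PMF (List (Letter I × V.Coin)) :=
  open scoped Classical in
  (PMF.uniformOfFintype (Fin I.v → I.Pt)).bind fun z =>
  (V.deliver (setupMessage I z) V.init).bind fun w₀ =>
  (V.deliver (inputStream I x β) w₀.2).bind fun w₁ =>
  (PMF.uniformOfFintype ((Fin (I.d * I.m) → Fin I.p → I.F) × Fin I.p)).bind fun yk =>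
  (V.deliver (algebraicCommitment I x β (V.line w₁.2) yk.1 yk.2) w₁.2).bind fun w₂ =>
  (V.deliver (algebraicDecommitment I β z (V.line w₁.2) yk.1 yk.2 (V.opening w₂.2)
    (V.line' w₂.2)) w₂.2).map fun w₃ =>
  w₀.1 ++ w₁.1 ++ w₂.1 ++ w₃.1

/-! ### Simulators -/

/-- The elementary operations of a simulator:
* `emit a`: append the prover symbol `a` to the view and receive the verifier's randomness for it;
* `stream`: read the next input symbol (which thereby appears in the view) and the verifier's
  randomness for it;
* `query a`: read the field element at address `a` of the random string `t`;
* `toss k`: sample a uniform element of `{0, …, k}`;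
* `halt`. -/
inductive Instr (I : PEP) (Coin State : Type) (N : ℕ) : Type
  | emit (a : ProverSymbol I) (next : Coin → State)
  | stream (next : Letter I → Coin → State)
  | query (a : Fin N) (next : I.F → State)
  | toss (k : ℕ) (next : Fin (k + 1) → State)
  | halt

/-- A streaming simulator: one pass over the input and over the randomness of the verifier, query
access to a uniformly random string `t ∈ F^N`, and fresh coins. The operation performed, including
the address of a query, is determined by the memory state. The running time is unrestricted. -/
structure Simulator (I : PEP) (Coin : Type) where
  State : Type
  [fintypeState : Fintype State]
  N : ℕ
  init : State
  program : State → Instr I Coin State N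
  time : ℕ

attribute [instance] Simulator.fintypeState

/-- The number of bits of memory of the simulator. -/
def Simulator.space {I : PEP} {Coin : Type} (S : Simulator I Coin) : ℝ :=
  Real.logb 2 (Fintype.card S.State)

/-- The output produced in a given number of operations, from a memory state and the remaining
input, with oracle `t`. -/
def Simulator.run {I : PEP} {Coin : Type} [Fintype Coin] [Nonempty Coin] (S : Simulator I Coin)
    (t : Fin S.N → I.F) : ℕ → S.State → List (Letter I) → PMF (List (Letter I × Coin))
  | 0, _, _ => PMF.pure []
  | T + 1, σ, input =>
    match S.program σ with
    | .emit a next =>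
        (PMF.uniformOfFintype Coin).bind fun c =>
          (S.run t T (next c) input).map fun w => (Letter.prover a, c) :: w
    | .stream next =>
        match input with
        | [] => PMF.pure []
        | b :: rest =>
            (PMF.uniformOfFintype Coin).bind fun c =>
              (S.run t T (next b c) rest).map fun w => (b, c) :: w
    | .query a next => S.run t T (next (t a)) input
    | .toss k next =>
        (PMF.uniformOfFintype (Fin (k + 1))).bind fun j => S.run t T (next j) input
    | .halt => PMF.pure []

/-- The simulated view on input `(x, β)`. -/
def simulatedView (I : PEP) {Coin : Type} [Fintype Coin] [Nonempty Coin] (S : Simulator I Coin)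
    (x : Fin I.n → I.Γ) (β : I.Pt) : PMF (List (Letter I × Coin)) :=
  open scoped Classical in
  (PMF.uniformOfFintype (Fin S.N → I.F)).bind fun t =>
    S.run t S.time S.init (inputStream I x β)

/-! ### Distinguishers -/

/-- A randomised streaming algorithm with a binary output over the alphabet `A`. -/
structure Distinguisher (A : Type) where
  State : Type
  [fintypeState : Fintype State]
  init : State
  step : State → A → PMF State
  accept : State → Bool

attribute [instance] Distinguisher.fintypeState

/-- The number of bits of memory of the distinguisher. -/
def Distinguisher.space {A : Type} (D : Distinguisher A) : ℝ :=
  Real.logb 2 (Fintype.card D.State)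

/-- The output distribution when the rest of the stream is read from a given memory state. -/
def Distinguisher.run {A : Type} (D : Distinguisher A) : List A → D.State → PMF Bool
  | [], σ => PMF.pure (D.accept σ)
  | a :: as, σ => (D.step σ a).bind (D.run as)

/-- The probability that `D` accepts a random stream. -/
def Distinguisher.acceptProb {A : Type} (D : Distinguisher A) (μ : PMF (List A)) : ℝ :=
  ((μ.bind fun w => D.run w D.init) true).toReal

/-! ### Streaming evaluation of `f^x` -/

/-- For every point `ρ`, the value `f^x(ρ)` can be computed by a one-pass algorithm that streams
`x` with at most `s` bits of memory. -/
def EvaluableInSpace (I : PEP) (s : ℝ) : Prop :=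
  ∀ ρ : I.Pt, ∃ (k : ℕ) (init : Fin k) (step : Fin k → I.Γ → Fin k) (out : Fin k → I.F),
    Real.logb 2 k ≤ s ∧
      ∀ x : Fin I.n → I.Γ,
        out ((List.ofFn x).foldl step init) = MvPolynomial.eval ρ (I.f x)

end ZKPep

end

/-! The simulator plays the honest prover with `z` and `y` taken from the random string. This string
can be reread, so nothing long is stored. Only the corrections are a problem: they involve f^x on a
line `L` that is announced after `x` has gone by. They are replaced by values that agree with f^x
wherever the verifier can plausibly open the temporal commitment.

Binding. For a verifier state σ after the setup, let H(σ) consist of the h = O(log q) pairs (ρ, ℓ)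
for which Pr[state σ and z_ℓ = ρ] is largest. Up to the opening the verifier depends on `z` only
through σ, so it opens correctly outside H with probability at most 1/h times the expected number of
correct pairs in H. With O(m log q) bits of memory this expectation is O(1), so the error is O(1/log
q) (`exists_binding`). As H depends on the verifier alone, it can be built into the simulator, which
evaluates f^x at the h points while `x` is streamed and commits to any values consistent with the
results and with f^x(β) = α (`simulatedValues`).

Hiding. Fix the parameter t of the opened point, and let r, r' be values with ∑ χ_i(t) (r_i - r'_i)
= 0. Adding Δ = r - r' to columns of `y` does not affect the last message, and adding it to column k
turns the corrections for r into those for r'. To tell r from r' is thus to notice a translation of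
one random column whose index is announced only after `y`. A memory with states S has advantage at
most log|S|/(λp) + λ in this (`ex_sub_shift_le`). Since t is chosen late, the bound is summed over
its q values and the case of no valid opening; p ≥ (dm)²q³ pays for the factor q + 1.

Both estimates rest on the maximal inequality `ex_ex_le_log`: if every fixed T_σ has exponential
moment at most B, then T_σ has mean at most log|S| + log B even when σ depends on the randomness.
The moments are computed by independence, of the columns of `y` for hiding and of the symbols of `z`
for binding.

The output of the simulator is exactly the view with the replaced values
(`simulatedView_simulator`), so there are no other errors. -/

noncomputable section

namespace ZKPep

/-! ### Finite expectations -/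

/-- The expectation of a real function on a finite type. -/
def ex {A : Type*} [Fintype A] (μ : PMF A) (f : A → ℝ) : ℝ := ∑ a, (μ a).toReal * f a

section Expectation

variable {A B : Type*} [Fintype A] [Fintype B]

theorem sum_toReal_eq_one (μ : PMF A) : ∑ a, (μ a).toReal = 1 := by
  rw [← ENNReal.toReal_sum fun a _ => μ.apply_ne_top a, ← tsum_fintype (L := .unconditional A),
    μ.tsum_coe, ENNReal.toReal_one]

theorem ex_pure (a : A) (f : A → ℝ) : ex (PMF.pure a) f = f a := by
  classical
  unfold ex
  rw [Finset.sum_eq_single a] <;> simp +contextual [PMF.pure_apply]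

theorem ex_bind (μ : PMF A) (κ : A → PMF B) (f : B → ℝ) :
    ex (μ.bind κ) f = ex μ fun a => ex (κ a) f := by
  unfold ex
  have h : ∀ b, ((μ.bind κ) b).toReal = ∑ a, (μ a).toReal * (κ a b).toReal := fun b => by
    rw [PMF.bind_apply, tsum_fintype, ENNReal.toReal_sum fun a _ =>
      ENNReal.mul_ne_top (μ.apply_ne_top a) ((κ a).apply_ne_top b)]
    simp [ENNReal.toReal_mul]
  simp only [h, Finset.sum_mul, Finset.mul_sum]
  rw [Finset.sum_comm]
  simp [mul_assoc]

theorem ex_map (μ : PMF A) (u : A → B) (f : B → ℝ) :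
    ex (μ.map u) f = ex μ fun a => f (u a) := by
  rw [← PMF.bind_pure_comp, ex_bind]
  simp [ex_pure]

theorem ex_const (μ : PMF A) (c : ℝ) : ex μ (fun _ => c) = c := by
  unfold ex
  rw [← Finset.sum_mul, sum_toReal_eq_one, one_mul]

theorem ex_mono (μ : PMF A) {f g : A → ℝ} (h : ∀ a, f a ≤ g a) : ex μ f ≤ ex μ g :=
  Finset.sum_le_sum fun a _ => mul_le_mul_of_nonneg_left (h a) ENNReal.toReal_nonneg

theorem ex_nonneg (μ : PMF A) {f : A → ℝ} (h : ∀ a, 0 ≤ f a) : 0 ≤ ex μ f :=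
  (ex_const μ 0).symm.le.trans (ex_mono μ h)

theorem ex_le_one (μ : PMF A) {f : A → ℝ} (h : ∀ a, f a ≤ 1) : ex μ f ≤ 1 :=
  (ex_mono μ h).trans (ex_const μ 1).le

theorem ex_add (μ : PMF A) (f g : A → ℝ) : ex μ (fun a => f a + g a) = ex μ f + ex μ g := by
  simp [ex, mul_add, Finset.sum_add_distrib]

theorem ex_sub (μ : PMF A) (f g : A → ℝ) : ex μ (fun a => f a - g a) = ex μ f - ex μ g := by
  simp [ex, mul_sub, Finset.sum_sub_distrib]

theorem ex_mul_left (μ : PMF A) (c : ℝ) (f : A → ℝ) : ex μ (fun a => c * f a) = c * ex μ f := by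
  simp only [ex, Finset.mul_sum]
  exact Finset.sum_congr rfl fun a _ => by ring

theorem ex_sum {ι : Type*} (s : Finset ι) (μ : PMF A) (f : ι → A → ℝ) :
    ex μ (fun a => ∑ i ∈ s, f i a) = ∑ i ∈ s, ex μ (f i) := by
  simp only [ex, Finset.mul_sum]
  exact Finset.sum_comm

theorem ex_comm (μ : PMF A) (ν : PMF B) (f : A → B → ℝ) :
    (ex μ fun a => ex ν (f a)) = ex ν fun b => ex μ fun a => f a b := by
  simp only [ex, Finset.mul_sum]
  rw [Finset.sum_comm]
  exact Finset.sum_congr rfl fun a _ => Finset.sum_congr rfl fun b _ => by ring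

theorem ex_uniform [Nonempty A] (f : A → ℝ) :
    ex (PMF.uniformOfFintype A) f = (∑ a, f a) / Fintype.card A := by
  simp [ex, PMF.uniformOfFintype_apply, ← Finset.mul_sum, div_eq_inv_mul]

theorem uniform_prod [Nonempty A] [Nonempty B] :
    PMF.uniformOfFintype (A × B) =
      (PMF.uniformOfFintype A).bind fun a => (PMF.uniformOfFintype B).map fun b => (a, b) := by
  classical
  ext ⟨a, b⟩
  simp only [PMF.uniformOfFintype_apply, PMF.bind_apply, PMF.map_apply, tsum_fintype,
    Fintype.card_prod, Prod.mk.injEq]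
  rw [Finset.sum_eq_single a, Finset.sum_eq_single b] <;> simp +contextual [eq_comm]
  rw [ENNReal.mul_inv] <;> simp

theorem uniform_map_equiv [Nonempty A] [Nonempty B] (e : A ≃ B) :
    (PMF.uniformOfFintype A).map e = PMF.uniformOfFintype B := by
  classical
  ext b
  simp only [PMF.uniformOfFintype_apply, PMF.map_apply, tsum_fintype, ← Fintype.card_congr e]
  rw [Finset.sum_eq_single (e.symm b)] <;> simp +contextual [Equiv.eq_symm_apply, eq_comm]

end Expectation

theorem sum_prod_apply {ι A : Type*} [Fintype ι] [DecidableEq ι] [Fintype A] (f : ι → A → ℝ) :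
    ∑ c : ι → A, ∏ i, f i (c i) = ∏ i, ∑ b, f i b := by
  rw [Finset.prod_univ_sum, Fintype.piFinset_univ]

/-! ### A maximal inequality -/

/-- The state may depend on `y` in any way, since exp(T_σ) is at most the sum of exp(T_σ') over all
states. Only the number of states matters. -/
theorem ex_ex_le_log {Y S : Type*} [Fintype Y] [Fintype S] (μ : PMF Y) (κ : Y → PMF S)
    (T : S → Y → ℝ) {B : ℝ} (hB : 0 < B) (hT : ∀ σ, ex μ (fun y => Real.exp (T σ y)) ≤ B) :
    (ex μ fun y => ex (κ y) fun σ => T σ y) ≤ Real.log (Fintype.card S) + Real.log B := by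
  obtain ⟨y₀, -⟩ := μ.support_nonempty
  obtain ⟨σ₀, -⟩ := (κ y₀).support_nonempty
  have : Nonempty S := ⟨σ₀⟩
  have hS : (0 : ℝ) < Fintype.card S := by exact_mod_cast Fintype.card_pos
  rw [← Real.log_mul hS.ne' hB.ne']
  -- For this `c`, the mean of c⁻¹ ∑ exp(T_σ') is at most 1, which cancels the -1 in the tangent
  -- inequality s ≤ log c - 1 + exp(s)/c.
  set c : ℝ := Fintype.card S * B with hc
  have hc0 : 0 < c := by positivity
  have key : ∀ y σ, T σ y ≤ (Real.log c - 1) + c⁻¹ * ∑ σ', Real.exp (T σ' y) := fun y σ => by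
    have h1 := Real.add_one_le_exp (T σ y - Real.log c)
    rw [Real.exp_sub, Real.exp_log hc0, div_eq_inv_mul] at h1
    have h2 : Real.exp (T σ y) ≤ ∑ σ', Real.exp (T σ' y) :=
      Finset.single_le_sum (f := fun σ' => Real.exp (T σ' y)) (fun _ _ => (Real.exp_pos _).le)
        (Finset.mem_univ σ)
    have h3 := mul_le_mul_of_nonneg_left h2 (inv_pos.2 hc0).le
    linarith
  calc (ex μ fun y => ex (κ y) fun σ => T σ y)
      ≤ ex μ fun y => (Real.log c - 1) + c⁻¹ * ∑ σ', Real.exp (T σ' y) :=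
        ex_mono _ fun y => (ex_mono _ (key y)).trans (ex_const _ _).le
    _ = (Real.log c - 1) + c⁻¹ * ∑ σ', ex μ fun y => Real.exp (T σ' y) := by
        rw [ex_add, ex_const, ex_mul_left, ex_sum]
    _ ≤ (Real.log c - 1) + c⁻¹ * ∑ _σ' : S, B := by
        gcongr with σ'
        exact hT σ'
    _ = Real.log c := by
        rw [Finset.sum_const, Finset.card_univ, nsmul_eq_mul, ← hc, inv_mul_cancel₀ hc0.ne']
        ring

/-! ### Random columns of a matrix are hidden from a small memory -/

section Hiding

variable {F : Type*} [Field F] {a p : ℕ}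

/-- Add the multiple `c j` of the vector `Δ` to the `j`-th column of `y`. -/
def shift (Δ : Fin a → F) (y : Fin a → Fin p → F) (c : Fin p → F) : Fin a → Fin p → F :=
  fun i j => y i j + c j * Δ i

theorem shift_shift (Δ : Fin a → F) (y : Fin a → Fin p → F) (c c' : Fin p → F) :
    shift Δ (shift Δ y c) c' = shift Δ y (c + c') := by
  funext i j
  simp [shift, add_mul, add_assoc]

/-- Translation of a matrix by a vector in every column, as a permutation. -/
def shiftEquiv (Δ : Fin a → F) (c : Fin p → F) : Equiv.Perm (Fin a → Fin p → F) where
  toFun y := shift Δ y c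
  invFun y := shift Δ y (-c)
  left_inv y := by funext i j; simp [shift]
  right_inv y := by funext i j; simp [shift]

/-- For |s| ≤ 1, exp(s) ≤ 1 + s + s². The linear terms sum to zero because b ↦ b + 1 permutes the
field, which leaves a quadratic error. -/
theorem sum_exp_sub_shift_le [Fintype F] {lam : ℝ} (h0 : 0 ≤ lam) (h1 : lam ≤ 1) (φ : F → ℝ)
    (hφ : ∀ b, 0 ≤ φ b ∧ φ b ≤ 1) :
    ∑ b, Real.exp (lam * (φ b - φ (b + 1))) ≤ Fintype.card F * Real.exp (lam ^ 2) := by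
  have hb : ∀ b, Real.exp (lam * (φ b - φ (b + 1))) ≤
      1 + lam ^ 2 + lam * (φ b - φ (b + 1)) := fun b => by
    have hx : |φ b - φ (b + 1)| ≤ 1 := by
      rw [abs_le]
      constructor <;> linarith [(hφ b).1, (hφ b).2, (hφ (b + 1)).1, (hφ (b + 1)).2]
    have hx' : |lam * (φ b - φ (b + 1))| ≤ lam := by
      rw [abs_mul, abs_of_nonneg h0]
      exact mul_le_of_le_one_right h0 hx
    have h2 := (abs_le.1 (Real.abs_exp_sub_one_sub_id_le (hx'.trans h1))).2
    have h3 : (lam * (φ b - φ (b + 1))) ^ 2 ≤ lam ^ 2 := sq_le_sq' (abs_le.1 hx').1 (abs_le.1 hx').2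
    linarith
  calc ∑ b, Real.exp (lam * (φ b - φ (b + 1)))
      ≤ ∑ b, (1 + lam ^ 2 + lam * (φ b - φ (b + 1))) := Finset.sum_le_sum fun b _ => hb b
    _ = Fintype.card F * (1 + lam ^ 2) := by
        have h := Equiv.sum_comp (Equiv.addRight (1 : F)) φ
        simp only [Equiv.coe_addRight] at h
        rw [Finset.sum_add_distrib, ← Finset.mul_sum, Finset.sum_sub_distrib, h]
        simp [mul_add]
    _ ≤ _ := by
        gcongr
        linarith [Real.add_one_le_exp (lam ^ 2)]

/-- A uniform `y` stays uniform when independent multiples `c j` of `Δ` are added to its columns.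
For fixed `y`, locality makes the k-th summand a function of `c k` alone, so the exponential moment
over `c` is a product of p factors, each bounded by `sum_exp_sub_shift_le`. -/
theorem ex_exp_sum_sub_shift_le [Fintype F] (Δ : Fin a → F) (G : Fin p → (Fin a → Fin p → F) → ℝ)
    (hG : ∀ k y, 0 ≤ G k y ∧ G k y ≤ 1)
    (hloc : ∀ k y c c', c k = c' k → G k (shift Δ y c) = G k (shift Δ y c'))
    {lam : ℝ} (h0 : 0 ≤ lam) (h1 : lam ≤ 1) :
    ex (PMF.uniformOfFintype (Fin a → Fin p → F))
      (fun y => Real.exp (∑ k, lam * (G k y - G k (shift Δ y 1)))) ≤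
      Real.exp (lam ^ 2 * p) := by
  classical
  set E : (Fin a → Fin p → F) → ℝ :=
    fun y => Real.exp (∑ k, lam * (G k y - G k (shift Δ y 1))) with hE
  rw [ex_uniform, div_le_iff₀ (by exact_mod_cast Fintype.card_pos)]
  have hfix : ∀ y, ∑ c : Fin p → F, E (shift Δ y c) ≤
      (Fintype.card F : ℝ) ^ p * Real.exp (lam ^ 2 * p) := fun y => by
    set φ : Fin p → F → ℝ := fun k b =>
      Real.exp (lam * (G k (shift Δ y fun _ => b) - G k (shift Δ y fun _ => b + 1))) with hφ
    have h2 : ∀ c : Fin p → F, E (shift Δ y c) = ∏ k, φ k (c k) :=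
      fun c => by
        simp only [hE, hφ]
        rw [Real.exp_sum]
        refine Finset.prod_congr rfl fun k _ => ?_
        rw [shift_shift, hloc k y c (fun _ => c k) rfl, hloc k y (c + 1) (fun _ => c k + 1) rfl]
    rw [Finset.sum_congr rfl fun c _ => h2 c, sum_prod_apply φ]
    calc _ ≤ ∏ _k : Fin p, (Fintype.card F * Real.exp (lam ^ 2)) :=
          Finset.prod_le_prod (fun _ _ => Finset.sum_nonneg fun _ _ => (Real.exp_pos _).le)
            fun k _ => sum_exp_sub_shift_le h0 h1 (fun b => G k (shift Δ y fun _ => b))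
              fun b => hG k _
      _ = _ := by
          rw [Finset.prod_const, Finset.card_univ, Fintype.card_fin, mul_pow, ← Real.exp_nat_mul,
            mul_comm (p : ℝ)]
  have hcard : (0 : ℝ) < (Fintype.card F : ℝ) ^ p := by
    have : (0 : ℝ) < Fintype.card F := by exact_mod_cast Fintype.card_pos
    positivity
  refine le_of_mul_le_mul_left ?_ hcard
  calc (Fintype.card F : ℝ) ^ p * ∑ y, E y = ∑ _c : Fin p → F, ∑ y, E y := by
        simp [Finset.sum_const, Finset.card_univ]
    _ = ∑ c : Fin p → F, ∑ y, E (shift Δ y c) :=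
        Finset.sum_congr rfl fun c _ => (Equiv.sum_comp (shiftEquiv Δ c) E).symm
    _ = ∑ y, ∑ c : Fin p → F, E (shift Δ y c) := Finset.sum_comm
    _ ≤ ∑ _y : Fin a → Fin p → F, (Fintype.card F : ℝ) ^ p * Real.exp (lam ^ 2 * p) :=
        Finset.sum_le_sum fun y _ => hfix y
    _ = _ := by
        rw [Finset.sum_const, Finset.card_univ, nsmul_eq_mul]
        ring

variable [Fintype F] [NeZero p] {S : Type*} [Fintype S]

/-- The maximal inequality for the sum over all columns gives log|S| + λ²p. Averaging over a uniform
k, drawn independently of the state, divides this by λp. -/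
theorem ex_sub_shift_le (κ : (Fin a → Fin p → F) → PMF S) (Δ : Fin a → F)
    (G : S → Fin p → (Fin a → Fin p → F) → ℝ) (hG : ∀ σ k y, 0 ≤ G σ k y ∧ G σ k y ≤ 1)
    (hloc : ∀ σ k y c c', c k = c' k → G σ k (shift Δ y c) = G σ k (shift Δ y c'))
    {lam : ℝ} (h0 : 0 < lam) (h1 : lam ≤ 1) :
    (ex (PMF.uniformOfFintype (Fin a → Fin p → F)) fun y =>
      ex (PMF.uniformOfFintype (Fin p)) fun k =>
        ex (κ y) fun σ => G σ k y - G σ k (shift Δ y 1)) ≤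
      Real.log (Fintype.card S) / (lam * p) + lam := by
  have h := ex_ex_le_log (PMF.uniformOfFintype (Fin a → Fin p → F)) κ
    (fun σ y => ∑ k, lam * (G σ k y - G σ k (shift Δ y 1))) (Real.exp_pos (lam ^ 2 * p))
    fun σ => ex_exp_sum_sub_shift_le Δ (G σ) (hG σ) (hloc σ) h0.le h1
  have hp : (0 : ℝ) < p := by exact_mod_cast Nat.pos_of_ne_zero (NeZero.ne p)
  simp only [ex_uniform (A := Fin p), ← ex_sum, Fintype.card_fin]
  simp only [← Finset.mul_sum, ex_mul_left] at h
  simp only [div_eq_inv_mul, ex_mul_left]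
  rw [Real.log_exp] at h
  have h2 : (lam * p) * ((p : ℝ)⁻¹ * ex (PMF.uniformOfFintype (Fin a → Fin p → F)) fun y =>
      ex (κ y) fun σ => ∑ k, (G σ k y - G σ k (shift Δ y 1))) ≤
      (lam * p) * ((lam * p)⁻¹ * Real.log (Fintype.card S) + lam) := by
    have e1 : ∀ X : ℝ, (lam * p) * ((p : ℝ)⁻¹ * X) = lam * X := fun X => by field_simp
    have e2 : ∀ X : ℝ, (lam * p) * ((lam * p)⁻¹ * X + lam) = X + lam ^ 2 * p := fun X => by
      field_simp
    rw [e1, e2]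
    exact h
  exact le_of_mul_le_mul_left h2 (by positivity)

theorem abs_ex_sub_shift_le (κ : (Fin a → Fin p → F) → PMF S) (Δ : Fin a → F)
    (G : S → Fin p → (Fin a → Fin p → F) → ℝ) (hG : ∀ σ k y, 0 ≤ G σ k y ∧ G σ k y ≤ 1)
    (hloc : ∀ σ k y c c', c k = c' k → G σ k (shift Δ y c) = G σ k (shift Δ y c'))
    {lam : ℝ} (h0 : 0 < lam) (h1 : lam ≤ 1) :
    |ex (PMF.uniformOfFintype (Fin a → Fin p → F)) fun y =>
      ex (PMF.uniformOfFintype (Fin p)) fun k =>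
        ex (κ y) fun σ => G σ k y - G σ k (shift Δ y 1)| ≤
      Real.log (Fintype.card S) / (lam * p) + lam := by
  rw [abs_le']
  refine ⟨ex_sub_shift_le κ Δ G hG hloc h0 h1, ?_⟩
  -- The hypotheses are symmetric under G ↦ 1 - G, which reverses the sign of the difference.
  have h := ex_sub_shift_le κ Δ (fun σ k y => 1 - G σ k y)
    (fun σ k y => ⟨by linarith [(hG σ k y).2], by linarith [(hG σ k y).1]⟩)
    (fun σ k y c c' hc => by rw [hloc σ k y c c' hc]) h0 h1
  refine le_trans (le_of_eq ?_) h
  rw [← neg_one_mul]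
  simp only [← ex_mul_left]
  congr! 6
  ring

end Hiding

/-! ### A small memory binds few coordinates of a random string -/

section Binding

open scoped Classical

variable {ι A S : Type*} [Fintype ι]

/-- The number of pairs in `H` that are correct guesses about `z`. -/
def hits (H : Finset (A × ι)) (z : ι → A) : ℝ := ∑ o ∈ H, if z o.2 = o.1 then 1 else 0

/-- A position holds one symbol, so at most one guess about it is correct. This writes the count as
a sum of functions of independent coordinates. -/
theorem hits_eq (H : Finset (A × ι)) (z : ι → A) :
    hits H z = ∑ l, if (z l, l) ∈ H then (1 : ℝ) else 0 := by
  unfold hits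
  rw [← Finset.sum_filter, ← Finset.sum_filter, Finset.sum_const, Finset.sum_const]
  congr 1
  refine Finset.card_bij (fun o _ => o.2) ?_ ?_ ?_
  · rintro ⟨a, l⟩ h
    simp only [Finset.mem_filter, Finset.mem_univ, true_and] at h ⊢
    rw [h.2]
    exact h.1
  · rintro ⟨a, l⟩ h ⟨a', l'⟩ h' hl
    simp only [Finset.mem_filter] at h h' hl
    subst hl
    rw [← h.2, h'.2]
  · intro l hl
    exact ⟨(z l, l), by simpa using hl, rfl⟩

variable [Fintype A] [Nonempty A]

/-- By independence the moment is a product over positions l of 1 + (exp λ - 1) n_l / |A|, with n_l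
the number of guesses about l. Since 1 + s ≤ exp(s), it is at most exp((exp λ - 1)|H| / |A|). -/
theorem ex_exp_hits_le (H : Finset (A × ι)) {lam : ℝ} (h0 : 0 ≤ lam)
    (hH : (Real.exp lam - 1) * H.card ≤ Fintype.card A) :
    ex (PMF.uniformOfFintype (ι → A)) (fun z => Real.exp (lam * hits H z)) ≤ Real.exp 1 := by
  have hA : (0 : ℝ) < Fintype.card A := by exact_mod_cast Fintype.card_pos
  have hl : 0 ≤ Real.exp lam - 1 := by linarith [Real.add_one_le_exp lam]
  rw [ex_uniform, div_le_iff₀ (by exact_mod_cast Fintype.card_pos)]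
  set φ : ι → A → ℝ := fun l a => if (a, l) ∈ H then Real.exp lam else 1 with hφ
  have h2 : ∀ z : ι → A, Real.exp (lam * hits H z) = ∏ l, φ l (z l) := fun z => by
    simp only [hφ]
    rw [hits_eq, Finset.mul_sum, Real.exp_sum]
    refine Finset.prod_congr rfl fun l _ => ?_
    split_ifs <;> simp
  rw [Finset.sum_congr rfl fun z _ => h2 z, sum_prod_apply φ]
  simp only [hφ]
  have h3 : ∀ l, ∑ a, (if (a, l) ∈ H then Real.exp lam else 1) ≤ Fintype.card A *
      Real.exp ((Real.exp lam - 1) / Fintype.card A * ∑ a, if (a, l) ∈ H then (1 : ℝ) else 0) :=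
    fun l => by
      have h4 : ∑ a, (if (a, l) ∈ H then Real.exp lam else 1) =
          Fintype.card A * ((Real.exp lam - 1) / Fintype.card A *
            (∑ a, if (a, l) ∈ H then (1 : ℝ) else 0) + 1) := by
        have h5 : ∀ a, (if (a, l) ∈ H then Real.exp lam else 1) =
            (Real.exp lam - 1) * (if (a, l) ∈ H then (1 : ℝ) else 0) + 1 := fun a => by
          split_ifs <;> ring
        rw [Finset.sum_congr rfl fun a _ => h5 a, Finset.sum_add_distrib, ← Finset.mul_sum,
          mul_add, ← mul_assoc, mul_div_cancel₀ _ hA.ne']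
        simp
      rw [h4]
      gcongr
      exact Real.add_one_le_exp _
  have hsum : ∑ l, ∑ a, (if (a, l) ∈ H then (1 : ℝ) else 0) = H.card := by
    rw [Finset.sum_comm, ← Finset.sum_product']
    simp
  calc ∏ l, ∑ a, (if (a, l) ∈ H then Real.exp lam else 1)
      ≤ ∏ l, (Fintype.card A * Real.exp ((Real.exp lam - 1) / Fintype.card A *
          ∑ a, if (a, l) ∈ H then (1 : ℝ) else 0)) :=
        Finset.prod_le_prod (fun l _ => Finset.sum_nonneg fun a _ => by
          split_ifs <;> positivity) fun l _ => h3 l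
    _ = Fintype.card (ι → A) * Real.exp ((Real.exp lam - 1) / Fintype.card A * H.card) := by
        rw [Finset.prod_mul_distrib, ← Real.exp_sum, ← Finset.mul_sum, hsum]
        simp
    _ ≤ Real.exp 1 * Fintype.card (ι → A) := by
        rw [mul_comm]
        gcongr
        rw [div_mul_eq_mul_div, div_le_one hA]
        exact hH

/-- `H` has maximal weight among the sets of at most `h` elements. If it is full, exchanging
elements shows that none outside outweighs one inside; if not, all elements outside have weight
zero. -/
theorem exists_heavy {O : Type*} [Fintype O] (W : O → ℝ) (hW : ∀ o, 0 ≤ W o) (h : ℕ) :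
    ∃ H : Finset O, H.card ≤ h ∧ ∀ o ∉ H, h * W o ≤ ∑ o' ∈ H, W o' := by
  obtain ⟨H, hH, hmax⟩ := Finset.exists_max_image
    (Finset.univ.filter fun H : Finset O => H.card ≤ h) (fun H => ∑ o ∈ H, W o) ⟨∅, by simp⟩
  simp only [Finset.mem_filter, Finset.mem_univ, true_and] at hH hmax
  refine ⟨H, hH, fun o ho => ?_⟩
  rcases hH.lt_or_eq with hlt | heq
  · have h1 := hmax (insert o H) (by rw [Finset.card_insert_of_notMem ho]; omega)
    rw [Finset.sum_insert ho] at h1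
    have h2 : W o = 0 := le_antisymm (by linarith) (hW o)
    rw [h2, mul_zero]
    exact Finset.sum_nonneg fun _ _ => hW _
  · rw [← heq, ← nsmul_eq_mul]
    refine Finset.card_nsmul_le_sum _ _ _ fun o' ho' => ?_
    have ho2 : o ∉ H.erase o' := fun hmem => ho (Finset.mem_of_mem_erase hmem)
    have h1 := hmax (insert o (H.erase o')) (by
      rw [Finset.card_insert_of_notMem ho2, Finset.card_erase_of_mem ho']
      have := Finset.card_pos.2 ⟨o', ho'⟩
      omega)
    rw [Finset.sum_insert ho2] at h1
    have h3 := Finset.add_sum_erase H W ho'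
    linarith

variable [Fintype S]

/-- After a uniformly random string `z` is read into a memory with states `S`, there are for every
state at most `h` guesses about `z` such that all other guesses are unlikely to be correct. -/
theorem exists_binding (κ : (ι → A) → PMF S) (h : ℕ) :
    ∃ H : S → Finset (A × ι), (∀ σ, (H σ).card ≤ h) ∧
      ∀ {S' : Type} [Fintype S'] (κ' : S → PMF S') (o : S' → A × ι) (b : S' → Prop) {lam : ℝ},
        0 < lam → (Real.exp lam - 1) * h ≤ Fintype.card A → 0 < h →
        (ex (PMF.uniformOfFintype (ι → A)) fun z => ex (κ z) fun σ => ex (κ' σ) fun σ' =>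
          if b σ' ∧ z (o σ').2 = (o σ').1 ∧ o σ' ∉ H σ then 1 else 0) ≤
          (Real.log (Fintype.card S) + 1) / (lam * h) := by
  -- `W σ o` is the joint probability that the state is σ and the guess `o` is correct; `H σ`
  -- collects the heaviest guesses for σ.
  set W : S → A × ι → ℝ := fun σ o =>
    ex (PMF.uniformOfFintype (ι → A)) fun z => (κ z σ).toReal * if z o.2 = o.1 then 1 else 0
    with hWdef
  have hW : ∀ σ o, 0 ≤ W σ o := fun σ o => ex_nonneg _ fun z =>
    mul_nonneg ENNReal.toReal_nonneg (by split_ifs <;> norm_num)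
  choose H hcard hH using fun σ => exists_heavy (W σ) (hW σ) h
  refine ⟨H, hcard, fun {S'} _ κ' o b {lam} h0 hlam hh => ?_⟩
  have hh' : (0 : ℝ) < h := by exact_mod_cast hh
  have hmain := ex_ex_le_log (PMF.uniformOfFintype (ι → A)) κ (fun σ z => lam * hits (H σ) z)
    (Real.exp_pos 1) fun σ => ex_exp_hits_le (H σ) h0.le (le_trans
      (mul_le_mul_of_nonneg_left (by exact_mod_cast hcard σ)
        (sub_nonneg.2 (Real.one_le_exp h0.le))) hlam)
  rw [Real.log_exp] at hmain
  simp only [ex_mul_left] at hmain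
  have hsumW : (ex (PMF.uniformOfFintype (ι → A)) fun z => ex (κ z) fun σ => hits (H σ) z) =
      ∑ σ, ∑ o' ∈ H σ, W σ o' := by
    simp only [hWdef, ← ex_sum]
    congr 1
    funext z
    simp only [ex, hits, Finset.mul_sum]
  rw [hsumW] at hmain
  -- Given σ, the guess `o σ'` is drawn independently of `z`. Outside `H σ` it is thus correct with
  -- joint probability at most the average weight in `H σ`.
  have hle : (ex (PMF.uniformOfFintype (ι → A)) fun z => ex (κ z) fun σ => ex (κ' σ) fun σ' =>
      if b σ' ∧ z (o σ').2 = (o σ').1 ∧ o σ' ∉ H σ then (1 : ℝ) else 0) ≤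
      ∑ σ, (h : ℝ)⁻¹ * ∑ o' ∈ H σ, W σ o' := by
    have h1 : (ex (PMF.uniformOfFintype (ι → A)) fun z => ex (κ z) fun σ => ex (κ' σ) fun σ' =>
        if b σ' ∧ z (o σ').2 = (o σ').1 ∧ o σ' ∉ H σ then (1 : ℝ) else 0) =
        ∑ σ, ex (κ' σ) fun σ' => if b σ' ∧ o σ' ∉ H σ then W σ (o σ') else 0 := by
      have h2 : ∀ z, (ex (κ z) fun σ => ex (κ' σ) fun σ' =>
          if b σ' ∧ z (o σ').2 = (o σ').1 ∧ o σ' ∉ H σ then (1 : ℝ) else 0) =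
          ∑ σ, ex (κ' σ) fun σ' => if b σ' ∧ o σ' ∉ H σ then
            (κ z σ).toReal * (if z (o σ').2 = (o σ').1 then 1 else 0) else 0 := fun z => by
        unfold ex
        refine Finset.sum_congr rfl fun σ _ => ?_
        rw [Finset.mul_sum]
        refine Finset.sum_congr rfl fun σ' _ => ?_
        by_cases hb : b σ' <;> by_cases hz : z (o σ').2 = (o σ').1 <;>
          by_cases ho : o σ' ∈ H σ <;> simp [hb, hz, ho]
        ring
      rw [funext h2, ex_sum]
      refine Finset.sum_congr rfl fun σ _ => ?_
      rw [ex_comm]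
      congr 1
      funext σ'
      split_ifs
      · rfl
      · exact ex_const _ _
    rw [h1]
    refine Finset.sum_le_sum fun σ _ => ?_
    refine (ex_mono _ fun σ' => ?_).trans (ex_const _ _).le
    split_ifs with hb
    · rw [← div_eq_inv_mul, le_div_iff₀ hh', mul_comm]
      exact hH σ _ hb.2
    · exact mul_nonneg (by positivity) (Finset.sum_nonneg fun _ _ => hW _ _)
  refine hle.trans ?_
  rw [← Finset.mul_sum, le_div_iff₀ (by positivity)]
  calc (h : ℝ)⁻¹ * (∑ σ, ∑ o' ∈ H σ, W σ o') * (lam * h) = lam * ∑ σ, ∑ o' ∈ H σ, W σ o' := by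
        field_simp
    _ ≤ _ := hmain

end Binding

/-! ### The joint evolution of a verifier and a distinguisher -/

section Joint

variable {I : PEP}

/-- The memory state after a stream is read. -/
def Distinguisher.runState {A : Type} (D : Distinguisher A) : List A → D.State → PMF D.State
  | [], σ => PMF.pure σ
  | a :: as, σ => (D.step σ a).bind (D.runState as)

/-- The memory state of the verifier after it reads a string. -/
def Verifier.chain (V : Verifier I) : List (Letter I) → V.State → PMF V.State
  | [], σ => PMF.pure σ
  | a :: as, σ => (PMF.uniformOfFintype V.Coin).bind fun c => V.chain as (V.step σ a c)

/-- The memory states of the distinguisher and of the verifier after a string is delivered. -/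
def joint (V : Verifier I) (D : Distinguisher (Letter I × V.Coin)) :
    List (Letter I) → D.State × V.State → PMF (D.State × V.State)
  | [], s => PMF.pure s
  | a :: as, s => (PMF.uniformOfFintype V.Coin).bind fun c =>
      (D.step s.1 (a, c)).bind fun δ => joint V D as (δ, V.step s.2 a c)

variable (V : Verifier I) (D : Distinguisher (Letter I × V.Coin))

theorem joint_append (as bs : List (Letter I)) (s : D.State × V.State) :
    joint V D (as ++ bs) s = (joint V D as s).bind (joint V D bs) := by
  induction as generalizing s with
  | nil => simp [joint]
  | cons a as ih => simp [joint, PMF.bind_bind, ih]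

/-- The distinguisher does not influence the verifier. Hence the binding error involves only the
verifier's memory, although the distinguisher may have much more. -/
theorem ex_joint_snd (as : List (Letter I)) (s : D.State × V.State) (f : V.State → ℝ) :
    ex (joint V D as s) (fun s' => f s'.2) = ex (V.chain as s.2) f := by
  induction as generalizing s with
  | nil => simp [joint, Verifier.chain, ex_pure]
  | cons a as ih => simp [joint, Verifier.chain, ex_bind, ih, ex_const]

/-- The distinguisher reads the finished view, but its coins are independent of the interaction, so
both can advance symbol by symbol. `Φ` is the rest of the interaction, which sees only the
verifier's state. -/
theorem deliver_bind_run (as : List (Letter I)) (δ : D.State) (σ : V.State)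
    (Φ : V.State → PMF (List (Letter I × V.Coin))) :
    ((V.deliver as σ).bind fun w => (Φ w.2).map fun u => w.1 ++ u).bind (fun u => D.run u δ) =
      (joint V D as (δ, σ)).bind fun s => (Φ s.2).bind fun u => D.run u s.1 := by
  induction as generalizing δ σ with
  | nil => simp [Verifier.deliver, joint, PMF.bind_map, Function.comp_def]
  | cons a as ih =>
    simp only [Verifier.deliver, joint, PMF.bind_bind, PMF.bind_map, Function.comp_def,
      List.cons_append, Distinguisher.run] at ih ⊢
    congr 1
    funext c
    simp only [← ih]
    rw [PMF.bind_comm (D.step δ (a, c))]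
    congr 1
    funext w
    rw [PMF.bind_comm]

theorem acceptProb_eq_ex (μ : PMF (List (Letter I × V.Coin))) :
    D.acceptProb μ = ex (μ.bind fun w => D.run w D.init) fun b => if b then 1 else 0 := by
  simp [Distinguisher.acceptProb, ex]

/-- The acceptance indicator. -/
def acceptInd (s : D.State × V.State) : ℝ := if D.accept s.1 then 1 else 0

theorem ex_deliver_run (as : List (Letter I)) (δ : D.State) (σ : V.State) :
    ex (((V.deliver as σ).map fun w => w.1).bind fun u => D.run u δ)
      (fun b => if b then (1 : ℝ) else 0) = ex (joint V D as (δ, σ)) (acceptInd V D) := by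
  have h := deliver_bind_run V D as δ σ fun _ => PMF.pure []
  simp only [PMF.pure_map, List.append_nil, PMF.pure_bind] at h
  rw [← PMF.bind_pure_comp]
  simp only [Function.comp_def]
  rw [h, ex_bind]
  simp only [Distinguisher.run, ex_pure]
  rfl

end Joint

/-! ### Views with arbitrary corrections -/

section Views

open scoped Classical

variable (I : PEP)

/-- The matrices that the prover may send. -/
abbrev PEP.Mat : Type := Fin (I.d * I.m) → Fin I.p → I.F

/-- The algebraic commitment to the values `r`. -/
def commitWith (β : I.Pt) (L : I.Line) (r : Fin (I.d * I.m) → I.F) (y : I.Mat) (k : Fin I.p) :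
    List (Letter I) :=
  if L.1 = β then commitMessage I y (fun i => r i - y i k) k else commitMessage I 0 0 0

/-- The view of the verifier `V` when the commitment is to values `g` that depend on the memory
state of `V` before and after the input. -/
def viewWith (V : Verifier I) (x : Fin I.n → I.Γ) (β : I.Pt)
    (g : V.State → V.State → Fin (I.d * I.m) → I.F) : PMF (List (Letter I × V.Coin)) :=
  (PMF.uniformOfFintype (Fin I.v → I.Pt)).bind fun z =>
  (V.deliver (setupMessage I z) V.init).bind fun w₀ =>
  (V.deliver (inputStream I x β) w₀.2).bind fun w₁ =>
  (PMF.uniformOfFintype (I.Mat × Fin I.p)).bind fun yk =>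
  (V.deliver (commitWith I β (V.line w₁.2) (g w₀.2 w₁.2) yk.1 yk.2) w₁.2).bind fun w₂ =>
  (V.deliver (algebraicDecommitment I β z (V.line w₁.2) yk.1 yk.2 (V.opening w₂.2)
    (V.line' w₂.2)) w₂.2).map fun w₃ =>
  w₀.1 ++ w₁.1 ++ w₂.1 ++ w₃.1

/-- The values of `f^x` at the points `1, …, dm` of a line. -/
def lineValues (x : Fin I.n → I.Γ) (L : I.Line) (i : Fin (I.d * I.m)) : I.F :=
  MvPolynomial.eval (PEP.lineAt L (I.node (i + 1))) (I.f x)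

theorem realView_eq_viewWith (V : Verifier I) (x : Fin I.n → I.Γ) (β : I.Pt) :
    realView I V x β = viewWith I V x β fun _ σ => lineValues I x (V.line σ) := rfl

variable {I}

theorem acceptProb_viewWith (V : Verifier I) (D : Distinguisher (Letter I × V.Coin))
    (x : Fin I.n → I.Γ) (β : I.Pt) (g : V.State → V.State → Fin (I.d * I.m) → I.F) :
    D.acceptProb (viewWith I V x β g) =
      ex (PMF.uniformOfFintype (Fin I.v → I.Pt)) fun z =>
      ex (joint V D (setupMessage I z) (D.init, V.init)) fun s₀ =>
      ex (joint V D (inputStream I x β) s₀) fun s₁ =>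
      ex (PMF.uniformOfFintype I.Mat) fun y =>
      ex (PMF.uniformOfFintype (Fin I.p)) fun k =>
      ex (joint V D (commitWith I β (V.line s₁.2) (g s₀.2 s₁.2) y k) s₁) fun s₂ =>
      ex (joint V D (algebraicDecommitment I β z (V.line s₁.2) y k (V.opening s₂.2)
        (V.line' s₂.2)) s₂) (acceptInd V D) := by
  -- Reassociated so that every message is followed by a continuation, which is the form that
  -- `deliver_bind_run` peels off.
  have h : viewWith I V x β g =
      (PMF.uniformOfFintype (Fin I.v → I.Pt)).bind fun z =>
      (V.deliver (setupMessage I z) V.init).bind fun w₀ =>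
      ((V.deliver (inputStream I x β) w₀.2).bind fun w₁ =>
      ((PMF.uniformOfFintype (I.Mat × Fin I.p)).bind fun yk =>
      (V.deliver (commitWith I β (V.line w₁.2) (g w₀.2 w₁.2) yk.1 yk.2) w₁.2).bind fun w₂ =>
      ((V.deliver (algebraicDecommitment I β z (V.line w₁.2) yk.1 yk.2 (V.opening w₂.2)
        (V.line' w₂.2)) w₂.2).map fun w₃ => w₃.1).map
      fun u => w₂.1 ++ u).map fun u => w₁.1 ++ u).map fun u => w₀.1 ++ u := by
    simp only [viewWith, PMF.map_bind, PMF.map_comp, Function.comp_def, List.append_assoc]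
  rw [acceptProb_eq_ex, h, PMF.bind_bind, ex_bind]
  congr 1
  funext z
  rw [deliver_bind_run V D _ _ _ fun σ₀ => (V.deliver (inputStream I x β) σ₀).bind fun w₁ =>
      ((PMF.uniformOfFintype (I.Mat × Fin I.p)).bind fun yk =>
      (V.deliver (commitWith I β (V.line w₁.2) (g σ₀ w₁.2) yk.1 yk.2) w₁.2).bind fun w₂ =>
      ((V.deliver (algebraicDecommitment I β z (V.line w₁.2) yk.1 yk.2 (V.opening w₂.2)
        (V.line' w₂.2)) w₂.2).map fun w₃ => w₃.1).map
      fun u => w₂.1 ++ u).map fun u => w₁.1 ++ u, ex_bind]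
  congr 1
  funext s₀
  rw [deliver_bind_run V D _ _ _ fun σ₁ =>
      ((PMF.uniformOfFintype (I.Mat × Fin I.p)).bind fun yk =>
      (V.deliver (commitWith I β (V.line σ₁) (g s₀.2 σ₁) yk.1 yk.2) σ₁).bind fun w₂ =>
      ((V.deliver (algebraicDecommitment I β z (V.line σ₁) yk.1 yk.2 (V.opening w₂.2)
        (V.line' w₂.2)) w₂.2).map fun w₃ => w₃.1).map fun u => w₂.1 ++ u), ex_bind]
  congr 1
  funext s₁
  rw [PMF.bind_bind, ex_bind, uniform_prod, ex_bind]
  congr 1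
  funext y
  rw [ex_map]
  congr 1
  funext k
  rw [deliver_bind_run V D _ _ _ fun σ₂ =>
      ((V.deliver (algebraicDecommitment I β z (V.line s₁.2) y k (V.opening σ₂)
        (V.line' σ₂)) σ₂).map fun w₃ => w₃.1), ex_bind]
  congr 1
  funext s₂
  exact ex_deliver_run V D _ _ _

/-! ### Views with different corrections are hard to distinguish -/

/-- A nonconstant line is injective. -/
theorem opensAt_unique {z : Fin I.v → I.Pt} {L : I.Line} {o : I.Pt × ℕ} {t t' : I.F}
    (h : OpensAt I z L o t) (h' : OpensAt I z L o t') : t = t' := by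
  by_contra hne
  refine h.2.1 (funext fun j => ?_)
  have h1 := congrFun (h.2.2.1.trans h'.2.2.1.symm) j
  simp only [PEP.lineAt, add_right_inj] at h1
  have h2 : (t - t') * (L.2 j - L.1 j) = 0 := by rw [sub_mul, h1, sub_self]
  exact (sub_eq_zero.1 ((mul_eq_zero.1 h2).resolve_left (sub_ne_zero.2 hne))).symm

/-- The algebraic decommitment, given the parameter `t` of the opened point, if any. -/
def decommitAt (t : Option I.F) (y : I.Mat) (k : Fin I.p) (L' : I.Line) : List (Letter I) :=
  match t with
  | none => decommitMessage I 0
  | some t => if L'.1 = I.coord k then decommitMessage I fun u =>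
      ∑ i : Fin (I.d * I.m), I.chi (I.d * I.m) (i + 1) t * I.lde (y i) (PEP.lineAt L' u)
      else decommitMessage I 0

/-- `t` is the parameter of the opened point, if any. -/
def OpensAtOption (z : Fin I.v → I.Pt) (L : I.Line) (o : I.Pt × ℕ) : Option I.F → Prop
  | none => ¬ ∃ t, OpensAt I z L o t
  | some t => OpensAt I z L o t

theorem existsUnique_opensAtOption (z : Fin I.v → I.Pt) (L : I.Line) (o : I.Pt × ℕ) :
    ∃! t, OpensAtOption z L o t := by
  by_cases h : ∃ t, OpensAt I z L o t
  · obtain ⟨t, ht⟩ := h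
    refine ⟨some t, ht, fun t' ht' => ?_⟩
    cases t' with
    | none => exact absurd ⟨t, ht⟩ ht'
    | some t' => rw [opensAt_unique ht ht']
  · refine ⟨none, h, fun t' ht' => ?_⟩
    cases t' with
    | none => rfl
    | some t' => exact absurd ⟨t', ht'⟩ h

theorem algebraicDecommitment_eq {β : I.Pt} {z : Fin I.v → I.Pt} {L : I.Line} (hL : L.1 = β)
    (y : I.Mat) (k : Fin I.p) {o : I.Pt × ℕ} (L' : I.Line) {t : Option I.F}
    (ht : OpensAtOption z L o t) :
    algebraicDecommitment I β z L y k o L' = decommitAt t y k L' := by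
  unfold algebraicDecommitment
  cases t with
  | none =>
    rw [dif_neg fun h => ht h.2.2]
    rfl
  | some t =>
    by_cases hk : L'.1 = I.coord k
    · have h : L.1 = β ∧ L'.1 = I.coord k ∧ ∃ t, OpensAt I z L o t := ⟨hL, hk, t, ht⟩
      rw [dif_pos h]
      simp only [decommitAt, if_pos hk, opensAt_unique h.2.2.choose_spec ht]
    · rw [dif_neg fun h => hk h.2.1]
      simp only [decommitAt, if_neg hk]

/-- By linearity of the low-degree extension, the last message depends on `y` only through one
linear combination of its rows. -/
theorem sum_chi_mul_lde (c : Fin (I.d * I.m) → I.F) (y : I.Mat) (u : I.Pt) :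
    ∑ i, c i * I.lde (y i) u =
      ∑ k : Fin I.p, (∑ i, c i * y i k) * ∏ j : Fin I.m, I.chi I.d (I.digit k j) (u j) := by
  simp only [PEP.lde, Finset.mul_sum, Finset.sum_mul]
  rw [Finset.sum_comm]
  simp only [mul_assoc]

/-- A translation along `Δ` changes the combined row by multiples of ∑ χ_i(t) Δ_i = 0. -/
theorem decommitAt_shift {Δ : Fin (I.d * I.m) → I.F} {t : Option I.F}
    (hΔ : ∀ t' ∈ t, ∑ i : Fin (I.d * I.m), I.chi (I.d * I.m) (i + 1) t' * Δ i = 0)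
    (y : I.Mat) (c : Fin I.p → I.F)
    (k : Fin I.p) (L' : I.Line) : decommitAt t (shift Δ y c) k L' = decommitAt t y k L' := by
  cases t with
  | none => rfl
  | some t =>
    have h : ∀ u, ∑ i : Fin (I.d * I.m), I.chi (I.d * I.m) (i + 1) t * I.lde (shift Δ y c i) u =
        ∑ i : Fin (I.d * I.m), I.chi (I.d * I.m) (i + 1) t * I.lde (y i) u := fun u => by
      rw [sum_chi_mul_lde, sum_chi_mul_lde]
      refine Finset.sum_congr rfl fun k _ => ?_
      congr 1
      simp only [shift, mul_add, Finset.sum_add_distrib, add_eq_left]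
      rw [← mul_zero (c k), ← hΔ t rfl, Finset.mul_sum]
      exact Finset.sum_congr rfl fun i _ => by ring
    simp only [decommitAt, h]

/-- The rows of the matrix sent in the algebraic commitment. -/
def entries (I : PEP) (y : I.Mat) : List (Letter I) :=
  (List.ofFn fun i => List.ofFn fun j => Letter.prover (.entry (y i j))).flatten

/-- The end of the algebraic commitment. -/
def corrections (I : PEP) (γ : Fin (I.d * I.m) → I.F) (k : Fin I.p) : List (Letter I) :=
  (List.ofFn fun i => Letter.prover (.correction (γ i))) ++ [Letter.prover (.index k)]

theorem commitMessage_eq (y : I.Mat) (γ : Fin (I.d * I.m) → I.F) (k : Fin I.p) :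
    commitMessage I y γ k = entries I y ++ corrections I γ k := by
  simp [commitMessage, entries, corrections]

/-! ### The end of the interaction for a fixed setup string, line and set of expected openings. -/

section Fixed

variable (V : Verifier I) (D : Distinguisher (Letter I × V.Coin)) (z : Fin I.v → I.Pt)
  (L : I.Line) (H : Finset (I.Pt × Fin I.v))

/-- The opening belongs to `H`. -/
def Expected (H : Finset (I.Pt × Fin I.v)) (o : I.Pt × ℕ) : Prop :=
  ∃ h : o.2 < I.v, (o.1, (⟨o.2, h⟩ : Fin I.v)) ∈ H

/-- The opening is correct but does not belong to `H`. -/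
def Unexpected (z : Fin I.v → I.Pt) (H : Finset (I.Pt × Fin I.v)) (o : I.Pt × ℕ) : Prop :=
  ∃ h : o.2 < I.v, z ⟨o.2, h⟩ = o.1 ∧ (o.1, (⟨o.2, h⟩ : Fin I.v)) ∉ H

theorem not_expected {z : Fin I.v → I.Pt} {L : I.Line} {H : Finset (I.Pt × Fin I.v)}
    {o : I.Pt × ℕ} {t : I.F} (ht : OpensAt I z L o t) (h : ¬ Expected H o) : Unexpected z H o := by
  obtain ⟨hv, hz⟩ := ht.1
  exact ⟨hv, hz, fun hm => h ⟨hv, hm⟩⟩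

/-- The opening has parameter `t`, and is in `H` if there is one. -/
def OpensExpected (t : Option I.F) (o : I.Pt × ℕ) : Prop :=
  OpensAtOption z L o t ∧ (t.isSome → Expected H o)

/-- The probability of acceptance, from a memory state after the matrix, together with the event
that the opening has parameter `t` and belongs to `H`. -/
def acceptAt (r : Fin (I.d * I.m) → I.F) (t : Option I.F) (s : D.State × V.State) (k : Fin I.p)
    (y : I.Mat) : ℝ :=
  ex (joint V D (corrections I (fun i => r i - y i k) k) s) fun s₂ =>
    if OpensExpected z L H t (V.opening s₂.2) then
      ex (joint V D (decommitAt t y k (V.line' s₂.2)) s₂) (acceptInd V D) else 0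

theorem acceptInd_nonneg (s : D.State × V.State) : 0 ≤ acceptInd V D s := by
  unfold acceptInd; split_ifs <;> norm_num

theorem acceptInd_le_one (s : D.State × V.State) : acceptInd V D s ≤ 1 := by
  unfold acceptInd; split_ifs <;> norm_num

theorem acceptAt_mem (r : Fin (I.d * I.m) → I.F) (t : Option I.F) (s : D.State × V.State)
    (k : Fin I.p) (y : I.Mat) :
    0 ≤ acceptAt V D z L H r t s k y ∧ acceptAt V D z L H r t s k y ≤ 1 := by
  refine ⟨ex_nonneg _ fun s₂ => ?_, ex_le_one _ fun s₂ => ?_⟩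
  · split_ifs
    · exact ex_nonneg _ (acceptInd_nonneg V D)
    · exact le_rfl
  · split_ifs
    · exact ex_le_one _ (acceptInd_le_one V D)
    · exact zero_le_one

variable {V D z L H} in
-- From a fixed memory state after the matrix, `y` enters through its column k, in the corrections,
-- and through the combined row, which the shift preserves. This provides the locality needed for
-- hiding, and for Δ = r - r' and c = 1 it replaces r by r'.
theorem acceptAt_shift (r : Fin (I.d * I.m) → I.F) {Δ : Fin (I.d * I.m) → I.F} {t : Option I.F}
    (hΔ : ∀ t' ∈ t, ∑ i : Fin (I.d * I.m), I.chi (I.d * I.m) (i + 1) t' * Δ i = 0)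
    (s : D.State × V.State)
    (k : Fin I.p) (y : I.Mat) (c : Fin I.p → I.F) :
    acceptAt V D z L H r t s k (shift Δ y c) =
      acceptAt V D z L H (fun i => r i - c k * Δ i) t s k y := by
  unfold acceptAt
  simp only [decommitAt_shift hΔ]
  congr! 4
  simp only [shift]
  ring

/-- The hiding bound with the memory after the matrix as `S`. It needs a fixed t: the verifier
chooses its opening only after it sees the corrections, but the allowed translations depend on t. -/
theorem abs_acceptAt_sub_le {r r' : Fin (I.d * I.m) → I.F} (t : Option I.F)
    (hr : L.1 ≠ L.2 → ∀ t' ∈ t, ∀ l, (PEP.lineAt L t', l) ∈ H →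
      ∑ i : Fin (I.d * I.m), I.chi (I.d * I.m) (i + 1) t' * r i =
        ∑ i : Fin (I.d * I.m), I.chi (I.d * I.m) (i + 1) t' * r' i)
    (κ : I.Mat → PMF (D.State × V.State)) {lam : ℝ} (h0 : 0 < lam) (h1 : lam ≤ 1) :
    |ex (PMF.uniformOfFintype I.Mat) fun y => ex (PMF.uniformOfFintype (Fin I.p)) fun k =>
      ex (κ y) fun s => acceptAt V D z L H r t s k y - acceptAt V D z L H r' t s k y| ≤
      Real.log (Fintype.card (D.State × V.State)) / (lam * I.p) + lam := by
  by_cases hΔ : ∀ t' ∈ t, ∑ i : Fin (I.d * I.m), I.chi (I.d * I.m) (i + 1) t' * (r i - r' i) = 0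
  · have h := abs_ex_sub_shift_le κ (fun i => r i - r' i)
      (fun s k y => acceptAt V D z L H r t s k y) (fun s k y => acceptAt_mem V D z L H r t s k y)
      (fun s k y c c' hc => by rw [acceptAt_shift r hΔ, acceptAt_shift r hΔ, hc]) h0 h1
    simp only [acceptAt_shift r hΔ, Pi.one_apply, one_mul, sub_sub_cancel] at h
    exact h
  -- If r and r' have different combinations at t, then t is not the parameter of an opening in `H`,
  -- so the event in `acceptAt` is impossible.
  · have hz : ∀ r s k y, acceptAt V D z L H r t s k y = 0 := fun r s k y => by
      unfold acceptAt
      refine Eq.trans (congrArg _ ?_)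
        (ex_const (joint V D (corrections I (fun i => r i - y i k) k) s) 0)
      funext s₂
      refine if_neg fun ho => hΔ fun t' ht' => ?_
      cases ht'
      obtain ⟨hv, hm⟩ := ho.2 rfl
      have h2 : OpensAt I z L (V.opening s₂.2) t' := ho.1
      rw [← h2.2.2.1] at hm
      simp only [mul_sub, Finset.sum_sub_distrib]
      rw [hr h2.2.1 t' rfl _ hm, sub_self]
    simp only [hz, sub_self, ex_const, abs_zero]
    have hc : (1 : ℝ) ≤ Fintype.card (D.State × V.State) := by
      exact_mod_cast Fintype.card_pos_iff.2 ⟨(D.init, V.init)⟩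
    have := Real.log_nonneg hc
    positivity

/-- Exactly one value of t, counting `none`, describes the actual opening. The sum over t therefore
recovers acceptance except when the opening is correct and outside `H`. -/
theorem accept_le_sum (r : Fin (I.d * I.m) → I.F) (y : I.Mat) (k : Fin I.p)
    (s : D.State × V.State) :
    (∑ t, acceptAt V D z L H r t s k y ≤
      ex (joint V D (corrections I (fun i => r i - y i k) k) s) fun s₂ =>
        ex (joint V D (algebraicDecommitment I L.1 z L y k (V.opening s₂.2) (V.line' s₂.2)) s₂)
          (acceptInd V D)) ∧
    (ex (joint V D (corrections I (fun i => r i - y i k) k) s) fun s₂ =>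
        ex (joint V D (algebraicDecommitment I L.1 z L y k (V.opening s₂.2) (V.line' s₂.2)) s₂)
          (acceptInd V D)) ≤
      ∑ t, acceptAt V D z L H r t s k y +
        ex (joint V D (corrections I (fun i => r i - y i k) k) s) fun s₂ =>
          if Unexpected z H (V.opening s₂.2) then 1 else 0 := by
  unfold acceptAt
  rw [← ex_sum, ← ex_add]
  have key : ∀ s₂ : D.State × V.State, ∃ t₀, OpensAtOption z L (V.opening s₂.2) t₀ ∧
      ∑ t, (if OpensExpected z L H t (V.opening s₂.2) then
        ex (joint V D (decommitAt t y k (V.line' s₂.2)) s₂) (acceptInd V D) else 0) =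
      if t₀.isSome → Expected H (V.opening s₂.2) then
        ex (joint V D (algebraicDecommitment I L.1 z L y k (V.opening s₂.2) (V.line' s₂.2)) s₂)
          (acceptInd V D) else 0 := fun s₂ => by
    obtain ⟨t₀, ht₀, huniq⟩ := existsUnique_opensAtOption z L (V.opening s₂.2)
    refine ⟨t₀, ht₀, ?_⟩
    rw [Finset.sum_eq_single t₀ (fun t _ hne => if_neg fun h => hne (huniq t h.1)) (by simp),
      algebraicDecommitment_eq rfl y k _ ht₀]
    exact if_congr (and_iff_right ht₀) rfl rfl
  constructor
  · refine ex_mono _ fun s₂ => ?_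
    obtain ⟨t₀, -, h⟩ := key s₂
    rw [h]
    split_ifs
    · exact le_rfl
    · exact ex_nonneg _ (acceptInd_nonneg V D)
  · refine ex_mono _ fun s₂ => ?_
    obtain ⟨t₀, ht₀, h⟩ := key s₂
    rw [h]
    split_ifs with h1 h2 h2
    · linarith
    · linarith
    · linarith [ex_le_one (joint V D (algebraicDecommitment I L.1 z L y k (V.opening s₂.2)
        (V.line' s₂.2)) s₂) (acceptInd_le_one V D)]
    · exfalso
      cases t₀ with
      | none => exact h1 (by simp)
      | some t => exact h2 (not_expected ht₀ fun h3 => h1 fun _ => h3)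

end Fixed

theorem acceptProb_viewWith_sub_le (V : Verifier I) (D : Distinguisher (Letter I × V.Coin))
    (x : Fin I.n → I.Γ) (β : I.Pt) (H : V.State → Finset (I.Pt × Fin I.v))
    (g g' : V.State → V.State → Fin (I.d * I.m) → I.F)
    (hg : ∀ σ₀ σ₁, (V.line σ₁).1 = β → (V.line σ₁).1 ≠ (V.line σ₁).2 →
      ∀ t l, (PEP.lineAt (V.line σ₁) t, l) ∈ H σ₀ →
      ∑ i : Fin (I.d * I.m), I.chi (I.d * I.m) (i + 1) t * g σ₀ σ₁ i =
        ∑ i : Fin (I.d * I.m), I.chi (I.d * I.m) (i + 1) t * g' σ₀ σ₁ i)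
    {lam : ℝ} (h0 : 0 < lam) (h1 : lam ≤ 1) :
    D.acceptProb (viewWith I V x β g) - D.acceptProb (viewWith I V x β g') ≤
      (I.q + 1) * (Real.log (Fintype.card (D.State × V.State)) / (lam * I.p) + lam) +
      ex (PMF.uniformOfFintype (Fin I.v → I.Pt)) fun z =>
      ex (V.chain (setupMessage I z) V.init) fun σ₀ =>
      ex ((V.chain (inputStream I x β) σ₀).bind fun σ₁ =>
        (PMF.uniformOfFintype I.Mat).bind fun y => (PMF.uniformOfFintype (Fin I.p)).bind fun k =>
          V.chain (commitWith I β (V.line σ₁) (g σ₀ σ₁) y k) σ₁) fun σ₂ =>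
        if Unexpected z (H σ₀) (V.opening σ₂) then 1 else 0 := by
  set ε := (I.q + 1) * (Real.log (Fintype.card (D.State × V.State)) / (lam * I.p) + lam) with hε
  have hbad : (ex (PMF.uniformOfFintype (Fin I.v → I.Pt)) fun z =>
      ex (V.chain (setupMessage I z) V.init) fun σ₀ =>
      ex ((V.chain (inputStream I x β) σ₀).bind fun σ₁ =>
        (PMF.uniformOfFintype I.Mat).bind fun y => (PMF.uniformOfFintype (Fin I.p)).bind fun k =>
          V.chain (commitWith I β (V.line σ₁) (g σ₀ σ₁) y k) σ₁) fun σ₂ =>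
        if Unexpected z (H σ₀) (V.opening σ₂) then (1 : ℝ) else 0) =
      ex (PMF.uniformOfFintype (Fin I.v → I.Pt)) fun z =>
      ex (joint V D (setupMessage I z) (D.init, V.init)) fun s₀ =>
      ex (joint V D (inputStream I x β) s₀) fun s₁ =>
      ex (PMF.uniformOfFintype I.Mat) fun y =>
      ex (PMF.uniformOfFintype (Fin I.p)) fun k =>
      ex (joint V D (commitWith I β (V.line s₁.2) (g s₀.2 s₁.2) y k) s₁) fun s₂ =>
        if Unexpected z (H s₀.2) (V.opening s₂.2) then (1 : ℝ) else 0 := by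
    congr 1
    funext z
    rw [← ex_joint_snd V D (setupMessage I z) (D.init, V.init)]
    congr 1
    funext s₀
    rw [ex_bind, ← ex_joint_snd V D (inputStream I x β) s₀]
    congr 1
    funext s₁
    simp only [ex_bind]
    congr 1
    funext y
    congr 1
    funext k
    rw [← ex_joint_snd V D _ s₁]
  rw [hbad, acceptProb_viewWith, acceptProb_viewWith, sub_le_iff_le_add, add_assoc, ← ex_add,
    ← ex_const (PMF.uniformOfFintype (Fin I.v → I.Pt)) ε, ← ex_add]
  refine ex_mono _ fun z => ?_
  rw [← ex_add, ← ex_const (joint V D (setupMessage I z) (D.init, V.init)) ε, ← ex_add]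
  refine ex_mono _ fun s₀ => ?_
  rw [← ex_add, ← ex_const (joint V D (inputStream I x β) s₀) ε, ← ex_add]
  refine ex_mono _ fun s₁ => ?_
  set L := V.line s₁.2 with hL
  set r := g s₀.2 s₁.2 with hr
  set r' := g' s₀.2 s₁.2 with hr'
  have hlog : 0 ≤ Real.log (Fintype.card (D.State × V.State)) := Real.log_nonneg (by
    exact_mod_cast Fintype.card_pos_iff.2 ⟨(D.init, V.init)⟩)
  -- If L(0) ≠ β, the prover sends zeroes whatever the committed values are, and the two views
  -- continue identically.
  by_cases hβ : L.1 = β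
  swap
  · have hε0 : 0 ≤ ε := by positivity
    have hnn : 0 ≤ ex (PMF.uniformOfFintype I.Mat) fun y =>
        ex (PMF.uniformOfFintype (Fin I.p)) fun k =>
        ex (joint V D (commitWith I β L r y k) s₁) fun s₂ =>
          if Unexpected z (H s₀.2) (V.opening s₂.2) then (1 : ℝ) else 0 :=
      ex_nonneg _ fun y => ex_nonneg _ fun k => ex_nonneg _ fun s₂ => by
        split_ifs <;> norm_num
    have heq : ∀ y k, commitWith I β L r y k = commitWith I β L r' y k := fun y k => by
      simp [commitWith, hβ]
    simp only [heq] at hnn ⊢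
    linarith
  · subst hβ
    simp only [commitWith, if_true, commitMessage_eq, joint_append, ex_bind]
    set κ : I.Mat → PMF (D.State × V.State) := fun y => joint V D (entries I y) s₁ with hκ
    have hA : ∀ r y k, (ex (κ y) fun s => ∑ t, acceptAt V D z L (H s₀.2) r t s k y) ≤
        ex (κ y) fun s => ex (joint V D (corrections I (fun i => r i - y i k) k) s) fun s₂ =>
        ex (joint V D (algebraicDecommitment I L.1 z L y k (V.opening s₂.2) (V.line' s₂.2)) s₂)
          (acceptInd V D) := fun r y k =>
      ex_mono _ fun s => (accept_le_sum V D z L (H s₀.2) r y k s).1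
    have hB : ∀ r y k, (ex (κ y) fun s =>
        ex (joint V D (corrections I (fun i => r i - y i k) k) s) fun s₂ =>
        ex (joint V D (algebraicDecommitment I L.1 z L y k (V.opening s₂.2) (V.line' s₂.2)) s₂)
          (acceptInd V D)) ≤ (ex (κ y) fun s => ∑ t, acceptAt V D z L (H s₀.2) r t s k y) +
        ex (κ y) fun s => ex (joint V D (corrections I (fun i => r i - y i k) k) s) fun s₂ =>
          if Unexpected z (H s₀.2) (V.opening s₂.2) then 1 else 0 := fun r y k => by
      rw [← ex_add]
      exact ex_mono _ fun s => (accept_le_sum V D z L (H s₀.2) r y k s).2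
    have hC : (ex (PMF.uniformOfFintype I.Mat) fun y => ex (PMF.uniformOfFintype (Fin I.p)) fun k =>
        ex (κ y) fun s => ∑ t, acceptAt V D z L (H s₀.2) r t s k y) -
        (ex (PMF.uniformOfFintype I.Mat) fun y => ex (PMF.uniformOfFintype (Fin I.p)) fun k =>
        ex (κ y) fun s => ∑ t, acceptAt V D z L (H s₀.2) r' t s k y) ≤ ε := by
      simp only [← ex_sub, ← Finset.sum_sub_distrib, ex_sum]
      -- The q + 1 summands are the q possible parameters and the absence of a valid opening.
      calc _ ≤ ∑ _t : Option I.F,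
            (Real.log (Fintype.card (D.State × V.State)) / (lam * I.p) + lam) :=
            Finset.sum_le_sum fun t _ => (le_abs_self _).trans
              (abs_acceptAt_sub_le V D z L (H s₀.2) t
                (fun hne t' _ l hl => hg s₀.2 s₁.2 rfl hne t' l hl) κ h0 h1)
        _ = ε := by
            rw [Finset.sum_const, Finset.card_univ, Fintype.card_option, nsmul_eq_mul, hε]
            push_cast
            rfl
    have hA' := ex_mono (PMF.uniformOfFintype I.Mat) fun y =>
      ex_mono (PMF.uniformOfFintype (Fin I.p)) fun k => hA r' y k
    have hB' := ex_mono (PMF.uniformOfFintype I.Mat) fun y =>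
      ex_mono (PMF.uniformOfFintype (Fin I.p)) fun k => hB r y k
    simp only [ex_add] at hB'
    linarith

/-- `H` comes before the distinguisher, the input and the committed values, so it can be part of a
simulator's program. -/
theorem abs_acceptProb_viewWith_sub_le (V : Verifier I) (h : ℕ) :
    ∃ H : V.State → Finset (I.Pt × Fin I.v), (∀ σ, (H σ).card ≤ h) ∧
      ∀ (D : Distinguisher (Letter I × V.Coin)) (x : Fin I.n → I.Γ) (β : I.Pt)
        (g g' : V.State → V.State → Fin (I.d * I.m) → I.F),
        (∀ σ₀ σ₁, (V.line σ₁).1 = β → (V.line σ₁).1 ≠ (V.line σ₁).2 →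
          ∀ t l, (PEP.lineAt (V.line σ₁) t, l) ∈ H σ₀ →
          ∑ i : Fin (I.d * I.m), I.chi (I.d * I.m) (i + 1) t * g σ₀ σ₁ i =
            ∑ i : Fin (I.d * I.m), I.chi (I.d * I.m) (i + 1) t * g' σ₀ σ₁ i) →
        ∀ {lam mu : ℝ}, 0 < lam → lam ≤ 1 → 0 < mu → 0 < h →
        (Real.exp mu - 1) * h ≤ (I.q : ℝ) ^ I.m →
        |D.acceptProb (viewWith I V x β g) - D.acceptProb (viewWith I V x β g')| ≤
          (I.q + 1) * (Real.log (Fintype.card (D.State × V.State)) / (lam * I.p) + lam) +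
            (Real.log (Fintype.card V.State) + 1) / (mu * h) := by
  obtain ⟨H, hcard, hH⟩ := exists_binding (fun z => V.chain (setupMessage I z) V.init) h
  refine ⟨H, hcard, fun D x β g g' hg lam mu h0 h1 hmu hh hq => ?_⟩
  have hlog : 0 ≤ Real.log (Fintype.card V.State) := Real.log_nonneg (by
    exact_mod_cast Fintype.card_pos_iff.2 ⟨V.init⟩)
  have hbind : ∀ κ' : V.State → PMF V.State,
      (ex (PMF.uniformOfFintype (Fin I.v → I.Pt)) fun z =>
      ex (V.chain (setupMessage I z) V.init) fun σ₀ => ex (κ' σ₀) fun σ₂ =>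
        if Unexpected z (H σ₀) (V.opening σ₂) then (1 : ℝ) else 0) ≤
      (Real.log (Fintype.card V.State) + 1) / (mu * h) := fun κ' => by
    -- The rounding in the definition of `v` can give 0; then no opening is valid.
    rcases Nat.eq_zero_or_pos I.v with hv | hv
    · have : ∀ z σ₀ σ₂, ¬ Unexpected z (H σ₀) (V.opening σ₂) := fun z σ₀ σ₂ ⟨h, _⟩ => by omega
      simp only [this, if_false, ex_const]
      positivity
    -- An index out of range is sent to the dummy position 0 and excluded by the side condition on
    -- the state.
    · have h2 := hH κ' (fun σ => ((V.opening σ).1,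
        if h : (V.opening σ).2 < I.v then ⟨(V.opening σ).2, h⟩ else ⟨0, hv⟩))
        (fun σ => (V.opening σ).2 < I.v) hmu (by simpa [PEP.q] using hq) hh
      refine le_trans (le_of_eq ?_) h2
      congr! 7 with z σ₀ σ₂
      constructor
      · rintro ⟨h, hz⟩
        simpa [h] using hz
      · rintro ⟨h, hz⟩
        simp only [h, dif_pos] at hz
        exact ⟨h, hz⟩
  rw [abs_le']
  constructor
  · exact (acceptProb_viewWith_sub_le V D x β H g g' hg h0 h1).trans
      (add_le_add_right (hbind _) _)
  · rw [neg_sub]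
    exact (acceptProb_viewWith_sub_le V D x β H g' g
      (fun σ₀ σ₁ h2 h3 t l hl => (hg σ₀ σ₁ h2 h3 t l hl).symm) h0 h1).trans
      (add_le_add_right (hbind _) _)

end Views

/-! ### Simulated corrections -/

section Corrections

open scoped Classical

variable (I : PEP)

open Polynomial in
/-- The restriction of `f^x` to a line, as a polynomial. -/
def linePoly (x : Fin I.n → I.Γ) (L : I.Line) : I.F[X] :=
  MvPolynomial.aeval (fun j => C (L.1 j) + X * C (L.2 j - L.1 j)) (I.f x)

theorem eval_linePoly (x : Fin I.n → I.Γ) (L : I.Line) (t : I.F) :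
    (linePoly I x L).eval t = MvPolynomial.eval (PEP.lineAt L t) (I.f x) := by
  have h := MvPolynomial.eval₂_comp_left (Polynomial.evalRingHom t) Polynomial.C
    (fun j => Polynomial.C (L.1 j) + Polynomial.X * Polynomial.C (L.2 j - L.1 j)) (I.f x)
  rw [linePoly, MvPolynomial.aeval_def, MvPolynomial.eval, MvPolynomial.coe_eval₂Hom,
    ← Polynomial.coe_evalRingHom, Polynomial.algebraMap_eq, h]
  congr 1
  · ext a; simp
  · funext j; simp [PEP.lineAt]

theorem totalDegree_f_le (x : Fin I.n → I.Γ) : (I.f x).totalDegree ≤ I.d * I.m := by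
  refine Finset.sup_le fun s hs => ?_
  rw [Finsupp.sum_fintype _ _ fun _ => rfl]
  calc ∑ j, s j ≤ ∑ _j : Fin I.m, I.d := Finset.sum_le_sum fun j _ =>
        (MvPolynomial.monomial_le_degreeOf j hs).trans (I.degree_le x j)
    _ = I.d * I.m := by simp [mul_comm]

theorem natDegree_linePoly_le (x : Fin I.n → I.Γ) (L : I.Line) :
    (linePoly I x L).natDegree ≤ I.d * I.m := by
  have h := MvPolynomial.aeval_natDegree_le (m := I.d * I.m) (n := 1) (I.f x)
    (totalDegree_f_le I x)
    (fun j => Polynomial.C (L.1 j) + Polynomial.X * Polynomial.C (L.2 j - L.1 j))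
    fun j => by compute_degree
  simpa [linePoly] using h

/-- The value of `f^x` at a point of a line is determined by the values at `0, …, dm`. -/
theorem sum_chi_mul_lineValues (x : Fin I.n → I.Γ) (L : I.Line) (t : I.F) :
    ∑ i : Fin (I.d * I.m), I.chi (I.d * I.m) (i + 1) t * lineValues I x L i =
      MvPolynomial.eval (PEP.lineAt L t) (I.f x) -
        I.chi (I.d * I.m) 0 t * MvPolynomial.eval L.1 (I.f x) := by
  have hinj : Set.InjOn I.node (Finset.range (I.d * I.m + 1)) := I.node_inj.mono fun i hi => by
    have := I.dm_lt
    simp only [Finset.coe_range, Set.mem_Iio] at hi ⊢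
    omega
  have hdeg : (linePoly I x L).degree < (Finset.range (I.d * I.m + 1)).card := by
    rw [Finset.card_range]
    exact lt_of_le_of_lt (Polynomial.degree_le_natDegree)
      (by exact_mod_cast Nat.lt_succ_of_le (natDegree_linePoly_le I x L))
  -- The restriction to the line has degree at most dm and the dm + 1 nodes are distinct, as dm < q.
  -- The node 0 is split off because the value at L(0) is not committed to.
  have h := congrArg (Polynomial.eval t) (Lagrange.eq_interpolate hinj hdeg)
  rw [Lagrange.interpolate_apply, Polynomial.eval_finsetSum, Finset.sum_range_succ',
    eval_linePoly] at h
  simp only [Polynomial.eval_mul, Polynomial.eval_C, eval_linePoly, I.node_zero] at h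
  have h0 : PEP.lineAt L 0 = L.1 := by
    funext j
    simp [PEP.lineAt]
  rw [h, h0, ← Fin.sum_univ_eq_sum_range (fun i => MvPolynomial.eval (PEP.lineAt L
    (I.node (i + 1))) (I.f x) * Polynomial.eval t (Lagrange.basis (Finset.range (I.d * I.m + 1))
      I.node (i + 1))), mul_comm (MvPolynomial.eval L.1 (I.f x))]
  simp only [PEP.chi, lineValues, add_sub_cancel_right]
  exact Finset.sum_congr rfl fun i _ => mul_comm _ _

/-- `g` is consistent with the value `α` at `L(0)` and with the values `vals` at the points `pts`
on the line `L`. -/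
def Consistent {h : ℕ} (pts : Fin h → I.Pt) (vals : Fin h → I.F) (L : I.Line)
    (g : Fin (I.d * I.m) → I.F) : Prop :=
  ∀ j t, PEP.lineAt L t = pts j →
    ∑ i : Fin (I.d * I.m), I.chi (I.d * I.m) (i + 1) t * g i =
      vals j - I.chi (I.d * I.m) 0 t * I.α

/-- A choice of values at the points `1, …, dm` of a line that is consistent with `vals`. -/
def simulatedValues {h : ℕ} (pts : Fin h → I.Pt) (vals : Fin h → I.F) (L : I.Line) :
    Fin (I.d * I.m) → I.F :=
  if H : ∃ g, Consistent I pts vals L g then H.choose else 0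

theorem consistent_lineValues {h : ℕ} (pts : Fin h → I.Pt) {x : Fin I.n → I.Γ} {β : I.Pt}
    (hx : (x, β) ∈ I.language) {L : I.Line} (hL : L.1 = β) :
    Consistent I pts (fun j => MvPolynomial.eval (pts j) (I.f x)) L (lineValues I x L) :=
  fun j t ht => by
    rw [sum_chi_mul_lineValues, ht, hL, show MvPolynomial.eval β (I.f x) = I.α from hx]

/-- The true values of f^x on the line are a witness, so the default 0 is not used here. -/
theorem consistent_simulatedValues {h : ℕ} (pts : Fin h → I.Pt) {x : Fin I.n → I.Γ} {β : I.Pt}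
    (hx : (x, β) ∈ I.language) {L : I.Line} (hL : L.1 = β) :
    Consistent I pts (fun j => MvPolynomial.eval (pts j) (I.f x)) L
      (simulatedValues I pts (fun j => MvPolynomial.eval (pts j) (I.f x)) L) := by
  have H : ∃ g, Consistent I pts (fun j => MvPolynomial.eval (pts j) (I.f x)) L g :=
    ⟨_, consistent_lineValues I pts hx hL⟩
  rw [simulatedValues, dif_pos H]
  exact H.choose_spec

/-- An enumeration of the points in a set of openings. -/
theorem exists_points {h : ℕ} (H : Finset (I.Pt × Fin I.v)) (hH : H.card ≤ h) :
    ∃ pts : Fin h → I.Pt, ∀ o ∈ H, ∃ j, pts j = o.1 := by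
  refine ⟨fun j => (H.toList.map Prod.fst).getD j 0, fun o ho => ?_⟩
  obtain ⟨j, hj, rfl⟩ := List.getElem_of_mem (Finset.mem_toList.2 ho)
  rw [Finset.length_toList] at hj
  refine ⟨⟨j, hj.trans_le hH⟩, ?_⟩
  simp [List.getD_eq_getElem?_getD, hj]

/-- A one-pass algorithm with `K` memory states that evaluates `f^x` at `ρ`. -/
structure Evaluator (ρ : I.Pt) (K : ℕ) where
  init : Fin K
  step : Fin K → I.Γ → Fin K
  out : Fin K → I.F
  out_foldl : ∀ x : Fin I.n → I.Γ,
    out ((List.ofFn x).foldl step init) = MvPolynomial.eval ρ (I.f x)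

variable {I} in
theorem q_ge_two : 2 ≤ I.q := Fintype.one_lt_card

variable {I} in
theorem card_le_of_logb_le {k c : ℕ} (hk : 0 < k) (h : Real.logb 2 k ≤ c * (I.m * I.logq)) :
    k ≤ I.q ^ (c * I.m) := by
  have hq : (0 : ℝ) < I.q := by exact_mod_cast (by have := q_ge_two (I := I); omega : 0 < I.q)
  have h2 : Real.logb 2 k ≤ Real.logb 2 ((I.q : ℝ) ^ (c * I.m)) := by
    rw [Real.logb_pow]
    push_cast
    rw [PEP.logq] at h
    linarith
  exact_mod_cast (Real.logb_le_logb one_lt_two (by exact_mod_cast hk) (by positivity)).1 h2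

variable {I} in
-- The evaluators for different points get a common number of states, so that the memory of all of
-- them is a function into a single `Fin K`.
theorem nonempty_evaluator {cf : ℕ} (h : EvaluableInSpace I (cf * (I.m * I.logq))) (ρ : I.Pt) :
    Nonempty (Evaluator I ρ (I.q ^ (cf * I.m))) := by
  obtain ⟨k, init, step, out, hk, hout⟩ := h ρ
  have hk' := card_le_of_logb_le init.pos hk
  have : Nonempty (Fin k) := ⟨init⟩
  set e : Fin k → Fin (I.q ^ (cf * I.m)) := Fin.castLE hk' with he
  have hinv : ∀ a, Function.invFun e (e a) = a :=
    Function.leftInverse_invFun (Fin.castLE_injective hk')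
  refine ⟨⟨e init, fun a b => e (step (Function.invFun e a) b),
    fun a => out (Function.invFun e a), fun x => ?_⟩⟩
  rw [← hout x]
  have hf : ∀ (l : List I.Γ) (a : Fin k),
      l.foldl (fun a b => e (step (Function.invFun e a) b)) (e a) = e (l.foldl step a) := fun l => by
    induction l with
    | nil => simp
    | cons b l ih => intro a; simp [hinv, ih]
  rw [hf, hinv]

end Corrections

/-! ### Simulators from lists of operations -/

section Machine

variable {I : PEP} {C : Type} [Fintype C] [Nonempty C] {M : Type} {N : ℕ}

/-- An operation on a memory `M`, other than to read the input. -/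
inductive Op (I : PEP) (C M : Type) (N : ℕ) : Type
  | emit (a : M → ProverSymbol I) (next : M → C → M)
  | query (a : M → Fin N) (next : M → I.F → M)
  | toss (k : ℕ) (next : M → Fin (k + 1) → M)

/-- The output of a list of operations and the resulting memory. -/
def exec (t : Fin N → I.F) : List (Op I C M N) → M → PMF (List (Letter I × C) × M)
  | [], μ => PMF.pure ([], μ)
  | .emit a next :: ops, μ =>
      (PMF.uniformOfFintype C).bind fun c =>
        (exec t ops (next μ c)).map fun w => ((Letter.prover (a μ), c) :: w.1, w.2)
  | .query a next :: ops, μ => exec t ops (next μ (t (a μ)))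
  | .toss k next :: ops, μ =>
      (PMF.uniformOfFintype (Fin (k + 1))).bind fun j => exec t ops (next μ j)

/-- The output and the resulting memory when the input is read. -/
def readInput (rd : M → Letter I → C → M) : List (Letter I) → M → PMF (List (Letter I × C) × M)
  | [], μ => PMF.pure ([], μ)
  | b :: bs, μ => (PMF.uniformOfFintype C).bind fun c =>
      (readInput rd bs (rd μ b c)).map fun w => ((b, c) :: w.1, w.2)

theorem exec_append (t : Fin N → I.F) (ops ops' : List (Op I C M N)) (μ : M) :
    exec t (ops ++ ops') μ =
      (exec t ops μ).bind fun w => (exec t ops' w.2).map fun w' => (w.1 ++ w'.1, w'.2) := by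
  induction ops generalizing μ with
  | nil =>
    simp only [List.nil_append, exec, PMF.pure_bind]
    exact (PMF.map_id _).symm
  | cons o ops ih =>
    cases o <;>
      simp [exec, ih, PMF.bind_bind, PMF.bind_map, PMF.map_bind, PMF.map_comp, Function.comp_def]

theorem exec_query (t : Fin N → I.F) (qs : List ((M → Fin N) × (M → I.F → M))) (μ : M) :
    exec t (qs.map fun s => (Op.query s.1 s.2 : Op I C M N)) μ =
      PMF.pure ([], qs.foldl (fun μ s => s.2 μ (t (s.1 μ))) μ) := by
  induction qs generalizing μ with
  | nil => simp [exec]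
  | cons s qs ih => simp [exec, ih]

/-- If every block emits one letter and restores the memory to a function of the verifier's state
alone, a list of blocks acts exactly like the delivery of a message. -/
theorem exec_flatMap (t : Fin N → I.F) (V : Verifier I) {A : Type}
    (blk : A → List (Op I V.Coin M N)) (let' : A → Letter I) (mem : V.State → M)
    (h : ∀ a σ, exec t (blk a) (mem σ) =
      (PMF.uniformOfFintype V.Coin).map fun c => ([(let' a, c)], mem (V.step σ (let' a) c)))
    (l : List A) (σ : V.State) :
    exec t (l.flatMap blk) (mem σ) =
      (V.deliver (l.map let') σ).map fun w => (w.1, mem w.2) := by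
  induction l generalizing σ with
  | nil => simp [exec, Verifier.deliver, PMF.pure_map]
  | cons a l ih =>
    simp [exec_append, Verifier.deliver, h, ih, PMF.bind_map, PMF.map_bind, PMF.map_comp,
      Function.comp_def]

/-- The instruction for an operation, with the index of the next operation. -/
def Op.instr {S : Type} (go : M → S) (μ : M) : Op I C M N → Instr I C S N
  | .emit a next => .emit (a μ) fun c => go (next μ c)
  | .query a next => .query (a μ) fun b => go (next μ b)
  | .toss k next => .toss k fun j => go (next μ j)

/-- The simulator that performs a list of operations, where `none` stands for reading the input
up to the point. -/
abbrev machine [Fintype M] (ops : List (Option (Op I C M N))) (rd : M → Letter I → C → M) (μ₀ : M)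
    (time : ℕ) : Simulator I C where
  State := Fin (ops.length + 1) × M
  N := N
  init := (0, μ₀)
  program s :=
    match ops[(s.1 : ℕ)]? with
    | none => .halt
    | some none => .stream fun b c =>
        match b with
        | .point _ => (Fin.ofNat _ (s.1 + 1), rd s.2 b c)
        | _ => (s.1, rd s.2 b c)
    | some (some o) => o.instr (fun μ => (Fin.ofNat _ (s.1 + 1), μ)) s.2
  time := time

section Run

variable {S : Simulator I C} (t : Fin S.N → I.F) (T : ℕ) {σ : S.State} (input : List (Letter I))

theorem run_emit {a : ProverSymbol I} {next : C → S.State} (h : S.program σ = .emit a next) :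
    S.run t (T + 1) σ input = (PMF.uniformOfFintype C).bind fun c =>
      (S.run t T (next c) input).map fun w => (Letter.prover a, c) :: w := by
  rw [Simulator.run.eq_def]
  simp only [h]

theorem run_stream {next : Letter I → C → S.State} (h : S.program σ = .stream next)
    (b : Letter I) :
    S.run t (T + 1) σ (b :: input) = (PMF.uniformOfFintype C).bind fun c =>
      (S.run t T (next b c) input).map fun w => (b, c) :: w := by
  rw [Simulator.run.eq_def]
  simp only [h]

theorem run_query {a : Fin S.N} {next : I.F → S.State} (h : S.program σ = .query a next) :
    S.run t (T + 1) σ input = S.run t T (next (t a)) input := by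
  rw [Simulator.run.eq_def]
  simp only [h]

theorem run_toss {k : ℕ} {next : Fin (k + 1) → S.State} (h : S.program σ = .toss k next) :
    S.run t (T + 1) σ input =
      (PMF.uniformOfFintype (Fin (k + 1))).bind fun j => S.run t T (next j) input := by
  rw [Simulator.run.eq_def]
  simp only [h]

theorem run_halt (h : S.program σ = .halt) : S.run t T σ input = PMF.pure [] := by
  rw [Simulator.run.eq_def]
  cases T <;> simp only [h]

end Run

variable [Fintype M] (ops : List (Option (Op I C M N))) (rd : M → Letter I → C → M) (μ₀ : M)
  (time : ℕ)

/-- The machine at the operation with index `i`. -/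
abbrev atOp (i : ℕ) (μ : M) : (machine ops rd μ₀ time).State := (Fin.ofNat _ i, μ)

theorem getElem?_of_drop {A : Type*} {l l' : List A} {i : ℕ} {a : A} (h : l.drop i = a :: l') :
    i < l.length ∧ l[i]? = some a ∧ l.drop (i + 1) = l' := by
  refine ⟨?_, ?_, ?_⟩
  · by_contra hi
    rw [List.drop_eq_nil_of_le (not_lt.1 hi)] at h
    simp at h
  · rw [← List.head?_drop, h]; rfl
  · rw [← List.tail_drop, h]; rfl

set_option linter.unusedSectionVars false in
theorem program_of_drop {i : ℕ} {o : Op I C M N} {rest : List (Option (Op I C M N))}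
    (h : ops.drop i = some o :: rest) (μ : M) :
    (machine ops rd μ₀ time).program (atOp ops rd μ₀ time i μ) =
      o.instr (atOp ops rd μ₀ time (i + 1)) μ := by
  obtain ⟨hi, ho, -⟩ := getElem?_of_drop h
  have hm : ((Fin.ofNat (ops.length + 1) i : Fin _) : ℕ) = i := Nat.mod_eq_of_lt (by omega)
  simp only [machine, hm, ho]

theorem run_machine_ops (t : Fin N → I.F) (os : List (Op I C M N))
    (rest : List (Option (Op I C M N))) (i : ℕ) (h : ops.drop i = os.map some ++ rest) (T : ℕ)
    (μ : M) (input : List (Letter I)) :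
    (machine ops rd μ₀ time).run t (os.length + T) (atOp ops rd μ₀ time i μ) input =
      (exec t os μ).bind fun w => ((machine ops rd μ₀ time).run t T
        (atOp ops rd μ₀ time (i + os.length) w.2) input).map fun u => w.1 ++ u := by
  induction os generalizing i μ with
  | nil =>
    simp only [exec, PMF.pure_bind, List.length_nil, zero_add, add_zero, List.nil_append]
    exact (PMF.map_id _).symm
  | cons o os ih =>
    have hp := program_of_drop ops rd μ₀ time h μ
    have ih' := ih (i + 1) (getElem?_of_drop h).2.2
    have hlen : (o :: os).length + T = os.length + T + 1 := by simp; omega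
    have hi : i + (o :: os).length = i + 1 + os.length := by simp; omega
    rw [hlen, hi]
    cases o with
    | emit a next =>
      rw [run_emit _ _ _ hp]
      simp [exec, ih', PMF.bind_bind, PMF.bind_map, PMF.map_bind, PMF.map_comp, Function.comp_def]
    | query a next =>
      rw [run_query _ _ _ hp]
      exact ih' _
    | toss k next =>
      rw [run_toss _ _ _ hp]
      simp [exec, ih', PMF.bind_bind]

/-- The program counter stays at the reading operation while symbols of `x` arrive and advances when
the point arrives, so the input needs no counter of its own. -/
theorem run_machine_input (t : Fin N → I.F) (rest : List (Option (Op I C M N))) (i : ℕ)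
    (h : ops.drop i = none :: rest) (T : ℕ) (l : List I.Γ) (β : I.Pt) (μ : M) :
    (machine ops rd μ₀ time).run t (l.length + 1 + T) (atOp ops rd μ₀ time i μ)
      (l.map Letter.symbol ++ [Letter.point β]) =
      (readInput rd (l.map Letter.symbol ++ [Letter.point β]) μ).bind fun w =>
        ((machine ops rd μ₀ time).run t T (atOp ops rd μ₀ time (i + 1) w.2) []).map
          fun u => w.1 ++ u := by
  obtain ⟨hi, ho, -⟩ := getElem?_of_drop h
  have hm : ((Fin.ofNat (ops.length + 1) i : Fin _) : ℕ) = i := Nat.mod_eq_of_lt (by omega)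
  have hp : ∀ μ, (machine ops rd μ₀ time).program (atOp ops rd μ₀ time i μ) =
      .stream fun b c => match b with
        | .point _ => atOp ops rd μ₀ time (i + 1) (rd μ b c)
        | _ => atOp ops rd μ₀ time i (rd μ b c) := fun μ => by
    simp only [machine, hm, ho]
  induction l generalizing μ with
  | nil =>
    rw [show ([] : List I.Γ).length + 1 + T = T + 1 by simp; omega, List.map_nil, List.nil_append,
      run_stream _ _ _ (hp μ)]
    simp [readInput, PMF.bind_bind, PMF.pure_map]
  | cons a l ih =>
    rw [show (a :: l).length + 1 + T = l.length + 1 + T + 1 by simp; omega, List.map_cons,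
      List.cons_append, run_stream _ _ _ (hp μ)]
    simp [readInput, ih, PMF.bind_bind, PMF.bind_map, PMF.map_bind, PMF.map_comp,
      Function.comp_def]

theorem run_machine_end (t : Fin N → I.F) (T : ℕ) (μ : M) :
    (machine ops rd μ₀ time).run t T (atOp ops rd μ₀ time ops.length μ) [] = PMF.pure [] :=
  run_halt _ _ _ (by simp [machine])

/-- The output of the simulator that performs `pre`, reads the input, and performs `post`. -/
theorem run_machine (t : Fin N → I.F) (pre post : List (Op I C M N)) (l : List I.Γ) (β : I.Pt) :
    (machine (pre.map some ++ none :: post.map some) rd μ₀ time).run t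
      (pre.length + (l.length + 1 + post.length))
      (machine (pre.map some ++ none :: post.map some) rd μ₀ time).init
      (l.map Letter.symbol ++ [Letter.point β]) =
      (exec t pre μ₀).bind fun w₀ =>
      (readInput rd (l.map Letter.symbol ++ [Letter.point β]) w₀.2).bind fun w₁ =>
      (exec t post w₁.2).map fun w₂ => w₀.1 ++ (w₁.1 ++ w₂.1) := by
  set ops : List (Option (Op I C M N)) := pre.map some ++ none :: post.map some with hops
  have h0 : (machine ops rd μ₀ time).init = atOp ops rd μ₀ time 0 μ₀ := rfl
  have h1 : ops.drop pre.length = none :: post.map some := by simp [hops]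
  have h2 : ops.drop (pre.length + 1) = post.map some ++ [] := by
    rw [(getElem?_of_drop h1).2.2, List.append_nil]
  have h3 : ops.length = pre.length + 1 + post.length := by simp [hops]; omega
  rw [h0, run_machine_ops ops rd μ₀ time t pre (none :: post.map some) 0 rfl]
  simp only [zero_add, run_machine_input ops rd μ₀ time t _ _ h1]
  have h4 := fun μ => run_machine_ops ops rd μ₀ time t post [] _ h2 0 μ []
  simp only [add_zero, ← h3, run_machine_end ops rd μ₀ time] at h4
  simp only [h4, PMF.map_bind, PMF.pure_map, List.append_nil]
  rfl

end Machine

/-! ### The simulator -/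

section Simulation

open scoped Classical

variable {I : PEP}

theorem deliver_append (V : Verifier I) (as bs : List (Letter I)) (σ : V.State) :
    V.deliver (as ++ bs) σ = (V.deliver as σ).bind fun w =>
      (V.deliver bs w.2).map fun w' => (w.1 ++ w'.1, w'.2) := by
  induction as generalizing σ with
  | nil =>
    simp only [List.nil_append, Verifier.deliver, PMF.pure_bind]
    exact (PMF.map_id _).symm
  | cons a as ih =>
    simp [Verifier.deliver, ih, PMF.bind_bind, PMF.bind_map, PMF.map_bind, PMF.map_comp,
      Function.comp_def]

theorem entries_eq_map (y : I.Mat) :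
    entries I y = (List.finRange (I.d * I.m) ×ˢ List.finRange I.p).map fun ij =>
      Letter.prover (.entry (y ij.1 ij.2)) := by
  simp only [entries, List.ofFn_eq_map, SProd.sprod, List.product, List.map_flatMap, List.map_map]
  rfl

variable (V : Verifier I) (h K : ℕ)

/-- The memory of the simulator: the states of the verifier before the input, now, after the input
and after the algebraic commitment, the memory of the evaluators, the outcome of the check of
`L(0)`, the index `k`, the outcome of the check of `z`, a buffer for a symbol of `z` and an
accumulator. -/
structure Mem where
  start : V.State
  cur : V.State
  afterInput : V.State
  afterCommit : V.State
  evals : Fin h → Fin K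
  ok : Bool
  index : Fin I.p
  opened : Bool
  buf : I.Pt
  acc : I.F

/-- The memory as a tuple. -/
def memEquiv : Mem V h K ≃ V.State × V.State × V.State × V.State × (Fin h → Fin K) × Bool ×
    Fin I.p × Bool × I.Pt × I.F where
  toFun μ := (μ.start, μ.cur, μ.afterInput, μ.afterCommit, μ.evals, μ.ok, μ.index, μ.opened, μ.buf,
    μ.acc)
  invFun s := ⟨s.1, s.2.1, s.2.2.1, s.2.2.2.1, s.2.2.2.2.1, s.2.2.2.2.2.1, s.2.2.2.2.2.2.1,
    s.2.2.2.2.2.2.2.1, s.2.2.2.2.2.2.2.2.1, s.2.2.2.2.2.2.2.2.2⟩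
  left_inv _ := rfl
  right_inv _ := rfl

instance : Fintype (Mem V h K) := Fintype.ofEquiv _ (memEquiv V h K).symm

/-- The addresses of the random string, which consists of `z` and `y`. -/
abbrev Address (I : PEP) : Type := (Fin I.v × Fin I.m) ⊕ (Fin (I.d * I.m) × Fin I.p)

/-- The position of an address. -/
def pos : Address I ≃ Fin (Fintype.card (Address I)) := Fintype.equivFin _

/-- The operations of the simulator. -/
abbrev SimOp : Type := Op I V.Coin (Mem V h K) (Fintype.card (Address I))

variable {V h K}

/-- The query operations at given addresses. -/
def queries (qs : List ((Mem V h K → Address I) × (Mem V h K → I.F → Mem V h K))) :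
    List (SimOp V h K) :=
  (qs.map fun s => (fun μ => pos (s.1 μ), s.2)).map fun s => Op.query s.1 s.2

/-- Append a symbol to the view. -/
def say (a : Mem V h K → ProverSymbol I) : SimOp V h K :=
  -- The accumulator is reset so that, between blocks, the memory is determined by the verifier's
  -- state, as in `exec_flatMap`.
  .emit a fun μ c => { μ with cur := V.step μ.cur (.prover (a μ)) c, acc := 0 }

variable (V h K) in
/-- Send a symbol of `z`. -/
def setupBlock (l : Fin I.v) : List (SimOp V h K) :=
  queries ((List.finRange I.m).map fun j =>
    (fun _ => .inl (l, j), fun μ b => { μ with buf := Function.update μ.buf j b })) ++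
  [.emit (fun μ => .setup μ.buf) fun μ c => { μ with
    start := V.step μ.cur (.prover (.setup μ.buf)) c
    cur := V.step μ.cur (.prover (.setup μ.buf)) c
    buf := 0 }]

variable (V h K) in
/-- Send an entry of `y`. -/
def entryBlock (ij : Fin (I.d * I.m) × Fin I.p) : List (SimOp V h K) :=
  queries [(fun _ => .inr ij, fun μ b => { μ with acc := b })] ++
  [say fun μ => .entry (if μ.ok then μ.acc else 0)]

variable (pts : V.State → Fin h → I.Pt) (ev : ∀ ρ, Evaluator I ρ K)

/-- The values to which the simulator commits. -/
def simValues (σ₀ : V.State) (e : Fin h → Fin K) (σ₁ : V.State) : Fin (I.d * I.m) → I.F :=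
  simulatedValues I (pts σ₀) (fun j => (ev (pts σ₀ j)).out (e j)) (V.line σ₁)

/-- Sample the index and start the evaluators. -/
def prepare : SimOp V h K :=
  -- The toss ranges over 0, …, p - 1. Drawing k before the input does not change the view, as k is
  -- independent of everything before the commitment.
  .toss (I.p - 1) fun μ k => { μ with
    evals := fun j => (ev (pts μ.start j)).init
    index := Fin.cast (Nat.succ_pred_eq_of_ne_zero (NeZero.ne I.p)) k }

/-- Process a symbol of the input. -/
def readStep (μ : Mem V h K) (b : Letter I) (c : V.Coin) : Mem V h K :=
  match b with
  | .symbol a => { μ with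
      cur := V.step μ.cur (.symbol a) c
      evals := fun j => (ev (pts μ.start j)).step (μ.evals j) a }
  | .point β => { μ with
      cur := V.step μ.cur (.point β) c
      afterInput := V.step μ.cur (.point β) c
      ok := decide ((V.line (V.step μ.cur (.point β) c)).1 = β) }
  | .prover _ => μ

/-- Send a correction. -/
def correctionBlock (i : Fin (I.d * I.m)) : List (SimOp V h K) :=
  queries [(fun μ => .inr (i, μ.index), fun μ b => { μ with acc := b })] ++
  [say fun μ => .correction
    (if μ.ok then simValues pts ev μ.start μ.evals μ.afterInput i - μ.acc else 0)]

variable (V h K) in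
/-- Send the index. -/
def indexBlock : List (SimOp V h K) :=
  [.emit (fun μ => .index (if μ.ok then μ.index else 0)) fun μ c => { μ with
    cur := V.step μ.cur (.prover (.index (if μ.ok then μ.index else 0))) c
    afterCommit := V.step μ.cur (.prover (.index (if μ.ok then μ.index else 0))) c
    opened := decide ((V.opening
      (V.step μ.cur (.prover (.index (if μ.ok then μ.index else 0))) c)).2 < I.v) }]

/-- The address of a coordinate of the symbol of `z` with index `l`, if there is one. -/
def openingAddress (I : PEP) (l : ℕ) (j : Fin I.m) : Address I :=
  -- The address for an index out of range is arbitrary: `opened` is already false in that case, and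
  -- the check only adds conjuncts.
  if hl : l < I.v then .inl (⟨l, hl⟩, j) else .inr (⟨0, Nat.mul_pos I.d_pos I.m_pos⟩, 0)

variable (V h K) in
/-- Check the temporal decommitment. -/
def checkBlock : List (SimOp V h K) :=
  queries ((List.finRange I.m).map fun j =>
    (fun μ => openingAddress I (V.opening μ.afterCommit).2 j,
    fun μ b => { μ with opened := μ.opened && decide (b = (V.opening μ.afterCommit).1 j) }))

/-- The parameter of the opened point, if the opening passes the check of `z`. -/
def openedAt (opened : Bool) (L : I.Line) (ρ : I.Pt) : Option I.F :=
  if H : opened = true ∧ ∃ t, L.1 ≠ L.2 ∧ PEP.lineAt L t = ρ ∧ ∀ a ≤ I.d * I.m, t ≠ I.node a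
  then some H.2.choose else none

/-- The weight of an entry of `y` in the evaluation of the last message at `u`. -/
def weight (V : Verifier I) (ok opened : Bool) (σ₁ σ₂ : V.State) (k : Fin I.p) (u : I.F)
    (ij : Fin (I.d * I.m) × Fin I.p) : I.F :=
  if ok then
    match openedAt opened (V.line σ₁) (V.opening σ₂).1 with
    | none => 0
    | some t => if (V.line' σ₂).1 = I.coord k then
        I.chi (I.d * I.m) (ij.1 + 1) t *
          ∏ j : Fin I.m, I.chi I.d (I.digit ij.2 j) (PEP.lineAt (V.line' σ₂) u j)
        else 0
  else 0

variable (V h K) in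
/-- Send an evaluation of the last message. -/
def evaluationBlock (e : Fin (I.d * I.m + 1)) : List (SimOp V h K) :=
  queries ((Finset.univ : Finset (Fin (I.d * I.m) × Fin I.p)).toList.map fun ij =>
    (fun _ => .inr ij, fun μ b => { μ with
      acc := μ.acc +
        weight V μ.ok μ.opened μ.afterInput μ.afterCommit μ.index (I.node e) ij * b })) ++
  [say fun μ => .evaluation μ.acc]

/-- The initial memory. -/
def mem₀ : Mem V h K :=
  { start := V.init, cur := V.init, afterInput := V.init, afterCommit := V.init,
    evals := fun j => (ev (pts V.init j)).init, ok := false, index := 0, opened := false,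
    buf := 0, acc := 0 }

/-- The operations before the input. -/
def opsBefore : List (SimOp V h K) :=
  (List.finRange I.v).flatMap (setupBlock V h K) ++ [prepare pts ev]

/-- The operations for the algebraic commitment. -/
def opsCommit : List (SimOp V h K) :=
  (List.finRange (I.d * I.m) ×ˢ List.finRange I.p).flatMap (entryBlock V h K) ++
    ((List.finRange (I.d * I.m)).flatMap (correctionBlock pts ev) ++ indexBlock V h K)

variable (V h K) in
/-- The operations for the algebraic decommitment. -/
def opsDecommit : List (SimOp V h K) :=
  checkBlock V h K ++ (List.finRange (I.d * I.m + 1)).flatMap (evaluationBlock V h K)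

/-- The simulator. -/
def simulator : Simulator I V.Coin :=
  machine ((opsBefore pts ev).map some ++
      none :: (opsCommit pts ev ++ opsDecommit V h K).map some) (readStep pts ev) (mem₀ pts ev)
    ((opsBefore pts ev).length + (I.n + 1 + (opsCommit pts ev ++ opsDecommit V h K).length))

/-! #### Semantics of the blocks -/

/-- The random string that consists of `z` and `y`. -/
def oracle (z : Fin I.v → I.Pt) (y : I.Mat) (a : Fin (Fintype.card (Address I))) : I.F :=
  match pos.symm a with
  | .inl s => z s.1 s.2
  | .inr s => y s.1 s.2

variable (z : Fin I.v → I.Pt) (y : I.Mat)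

@[simp] theorem oracle_inl (s : Fin I.v × Fin I.m) : oracle z y (pos (.inl s)) = z s.1 s.2 := by
  simp [oracle]

@[simp] theorem oracle_inr (s : Fin (I.d * I.m) × Fin I.p) :
    oracle z y (pos (.inr s)) = y s.1 s.2 := by
  simp [oracle]

theorem exec_queries (qs : List ((Mem V h K → Address I) × (Mem V h K → I.F → Mem V h K)))
    (μ : Mem V h K) :
    exec (oracle z y) (queries qs) μ =
      PMF.pure ([], qs.foldl (fun μ s => s.2 μ (oracle z y (pos (s.1 μ)))) μ) := by
  rw [queries, exec_query, List.foldl_map]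

theorem exec_queries_append
    (qs : List ((Mem V h K → Address I) × (Mem V h K → I.F → Mem V h K)))
    (ops : List (SimOp V h K)) (μ : Mem V h K) :
    exec (oracle z y) (queries qs ++ ops) μ =
      exec (oracle z y) ops (qs.foldl (fun μ s => s.2 μ (oracle z y (pos (s.1 μ)))) μ) := by
  rw [exec_append, exec_queries, PMF.pure_bind]
  exact PMF.map_id _

theorem exec_say (a : Mem V h K → ProverSymbol I) (μ : Mem V h K) :
    exec (oracle z y) [say a] μ = (PMF.uniformOfFintype V.Coin).map fun c =>
      ([(.prover (a μ), c)], { μ with cur := V.step μ.cur (.prover (a μ)) c, acc := 0 }) := by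
  simp only [say, exec, PMF.pure_map]
  exact PMF.bind_pure_comp _ _

/-- The memory while `z` is sent. -/
def memSetup (σ : V.State) : Mem V h K := { mem₀ pts ev with start := σ, cur := σ }

theorem exec_setupBlock (l : Fin I.v) (σ : V.State) :
    exec (oracle z y) (setupBlock V h K l) (memSetup pts ev σ) =
      (PMF.uniformOfFintype V.Coin).map fun c =>
        ([(.prover (.setup (z l)), c)], memSetup pts ev (V.step σ (.prover (.setup (z l))) c)) := by
  have hbuf : ∀ (js : List (Fin I.m)) (μ : Mem V h K),
      js.foldl (fun μ j => { μ with buf := Function.update μ.buf j (z l j) }) μ =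
        { μ with buf := fun j => if j ∈ js then z l j else μ.buf j } := fun js => by
    induction js with
    | nil => intro μ; simp
    | cons j js ih =>
      intro μ
      rw [List.foldl_cons, ih]
      simp only [Mem.mk.injEq, true_and, and_true]
      funext j'
      by_cases h1 : j' = j
      · subst h1; simp
      · simp [h1]
  rw [setupBlock, exec_queries_append, List.foldl_map]
  simp only [oracle_inl]
  rw [hbuf]
  simp only [List.mem_finRange, if_true, exec, PMF.pure_map]
  exact PMF.bind_pure_comp _ _

theorem setupMessage_eq_map : setupMessage I z =
    (List.finRange I.v).map fun l => Letter.prover (.setup (z l)) := List.ofFn_eq_map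

/-- The memory when the input is about to be read. -/
def memPrepared (σ₀ : V.State) (k : Fin I.p) : Mem V h K :=
  { mem₀ pts ev with
    start := σ₀, cur := σ₀, evals := fun j => (ev (pts σ₀ j)).init, index := k }

theorem exec_opsBefore :
    exec (oracle z y) (opsBefore pts ev) (mem₀ pts ev) =
      (V.deliver (setupMessage I z) V.init).bind fun w =>
        (PMF.uniformOfFintype (Fin I.p)).map fun k => (w.1, memPrepared pts ev w.2 k) := by
  have h1 : mem₀ pts ev = memSetup pts ev V.init := rfl
  rw [opsBefore, exec_append, h1, setupMessage_eq_map,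
    exec_flatMap _ V (setupBlock V h K) (fun l => Letter.prover (.setup (z l))) (memSetup pts ev)
      (exec_setupBlock pts ev z y), PMF.bind_map]
  congr 1
  funext w
  simp only [Function.comp_def, prepare, exec, PMF.map_bind, PMF.pure_map, List.append_nil]
  rw [← uniform_map_equiv (finCongr (Nat.succ_pred_eq_of_ne_zero (NeZero.ne I.p))), PMF.map_comp]
  exact PMF.bind_pure_comp _ _

/-- The memory after the input is read. -/
def memRead (σ₀ σ₁ : V.State) (e : Fin h → Fin K) (ok : Bool) (k : Fin I.p) : Mem V h K :=
  { start := σ₀, cur := σ₁, afterInput := σ₁, afterCommit := V.init, evals := e, ok := ok,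
    index := k, opened := false, buf := 0, acc := 0 }

/-- The memory of the evaluators after `x` is read. -/
def finalEvals (σ₀ : V.State) (x : Fin I.n → I.Γ) (j : Fin h) : Fin K :=
  (List.ofFn x).foldl (ev (pts σ₀ j)).step (ev (pts σ₀ j)).init

theorem readInput_inputStream (x : Fin I.n → I.Γ) (β : I.Pt) (σ₀ : V.State) (k : Fin I.p) :
    readInput (readStep pts ev) (inputStream I x β) (memPrepared pts ev σ₀ k) =
      (V.deliver (inputStream I x β) σ₀).map fun w =>
        (w.1, memRead σ₀ w.2 (finalEvals pts ev σ₀ x) (decide ((V.line w.2).1 = β)) k) := by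
  have hgen : ∀ (l : List I.Γ) (σ : V.State) (e : Fin h → Fin K),
      readInput (readStep pts ev) (l.map Letter.symbol ++ [Letter.point β])
        { memPrepared pts ev σ₀ k with cur := σ, evals := e } =
      (V.deliver (l.map Letter.symbol ++ [Letter.point β]) σ).map fun w =>
        (w.1, memRead σ₀ w.2 (fun j => l.foldl (ev (pts σ₀ j)).step (e j))
          (decide ((V.line w.2).1 = β)) k) := fun l => by
    induction l with
    | nil =>
      intro σ e
      simp [readInput, Verifier.deliver, readStep, PMF.pure_map, PMF.map_bind, memPrepared,
        memRead, mem₀]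
    | cons a l ih =>
      intro σ e
      simp only [List.map_cons, List.cons_append, readInput, Verifier.deliver, PMF.map_bind,
        List.foldl_cons, PMF.map_comp, Function.comp_def]
      congr 1
      funext c
      have h2 := ih (V.step σ (.symbol a) c) fun j => (ev (pts σ₀ j)).step (e j) a
      refine (congrArg _ h2).trans ?_
      rw [PMF.map_comp]
      rfl
  have h1 : inputStream I x β = (List.ofFn x).map Letter.symbol ++ [Letter.point β] := by
    simp [inputStream, List.map_ofFn, Function.comp_def]
  rw [h1]
  exact hgen _ _ _

variable (σ₀ σ₁ : V.State) (e : Fin h → Fin K) (ok : Bool) (k : Fin I.p)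

/-- The memory while the algebraic commitment is sent. -/
def memCommitting (σ : V.State) : Mem V h K := { memRead σ₀ σ₁ e ok k with cur := σ }

theorem exec_entryBlock (ij : Fin (I.d * I.m) × Fin I.p) (σ : V.State) :
    exec (oracle z y) (entryBlock V h K ij) (memCommitting σ₀ σ₁ e ok k σ) =
      (PMF.uniformOfFintype V.Coin).map fun c =>
        ([(.prover (.entry (if ok then y ij.1 ij.2 else 0)), c)],
          memCommitting σ₀ σ₁ e ok k
            (V.step σ (.prover (.entry (if ok then y ij.1 ij.2 else 0))) c)) := by
  rw [entryBlock, exec_queries_append, exec_say]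
  simp only [List.foldl_cons, List.foldl_nil, oracle_inr]
  rfl

theorem exec_correctionBlock (i : Fin (I.d * I.m)) (σ : V.State) :
    exec (oracle z y) (correctionBlock pts ev i) (memCommitting σ₀ σ₁ e ok k σ) =
      (PMF.uniformOfFintype V.Coin).map fun c =>
        ([(.prover (.correction (if ok then simValues pts ev σ₀ e σ₁ i - y i k else 0)), c)],
          memCommitting σ₀ σ₁ e ok k (V.step σ
            (.prover (.correction (if ok then simValues pts ev σ₀ e σ₁ i - y i k else 0))) c)) := by
  rw [correctionBlock, exec_queries_append, exec_say]
  simp only [List.foldl_cons, List.foldl_nil, oracle_inr]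
  rfl

/-- The memory while the algebraic decommitment is sent. -/
def memDecommitting (σ₂ : V.State) (opened : Bool) (σ : V.State) : Mem V h K :=
  { memRead σ₀ σ₁ e ok k with cur := σ, afterCommit := σ₂, opened := opened }

theorem exec_indexBlock (σ : V.State) :
    exec (oracle z y) (indexBlock V h K) (memCommitting σ₀ σ₁ e ok k σ) =
      (V.deliver [.prover (.index (if ok then k else 0))] σ).map fun w =>
        (w.1, memDecommitting σ₀ σ₁ e ok k w.2 (decide ((V.opening w.2).2 < I.v)) w.2) := by
  simp only [indexBlock, exec, Verifier.deliver, PMF.map_bind, PMF.pure_map]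
  rfl

theorem exec_opsCommit (β : I.Pt) :
    exec (oracle z y) (opsCommit pts ev)
      (memRead σ₀ σ₁ e (decide ((V.line σ₁).1 = β)) k) =
      (V.deliver (commitWith I β (V.line σ₁) (simValues pts ev σ₀ e σ₁) y k) σ₁).map fun w =>
        (w.1, memDecommitting σ₀ σ₁ e (decide ((V.line σ₁).1 = β)) k w.2
          (decide ((V.opening w.2).2 < I.v)) w.2) := by
  set ok : Bool := decide ((V.line σ₁).1 = β) with hok
  have h1 : commitWith I β (V.line σ₁) (simValues pts ev σ₀ e σ₁) y k =
      ((List.finRange (I.d * I.m) ×ˢ List.finRange I.p).map fun ij =>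
        Letter.prover (.entry (if ok then y ij.1 ij.2 else 0))) ++
      (((List.finRange (I.d * I.m)).map fun i => Letter.prover
        (.correction (if ok then simValues pts ev σ₀ e σ₁ i - y i k else 0))) ++
      [Letter.prover (.index (if ok then k else 0))]) := by
    by_cases hβ : (V.line σ₁).1 = β <;>
      simp [commitWith, hok, hβ, commitMessage_eq, entries_eq_map, corrections, List.ofFn_eq_map]
  have h2 : memRead σ₀ σ₁ e ok k = memCommitting σ₀ σ₁ e ok k σ₁ := rfl
  rw [opsCommit, h1, h2, exec_append, deliver_append,
    exec_flatMap _ V (entryBlock V h K)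
      (fun ij => Letter.prover (.entry (if ok then y ij.1 ij.2 else 0)))
      (memCommitting σ₀ σ₁ e ok k) (exec_entryBlock z y σ₀ σ₁ e ok k), PMF.bind_map, PMF.map_bind]
  congr 1
  funext w
  simp only [Function.comp_def]
  rw [exec_append, deliver_append,
    exec_flatMap _ V (correctionBlock pts ev) (fun i => Letter.prover
        (.correction (if ok then simValues pts ev σ₀ e σ₁ i - y i k else 0)))
      (memCommitting σ₀ σ₁ e ok k) (exec_correctionBlock pts ev z y σ₀ σ₁ e ok k), PMF.bind_map,
    PMF.map_bind, PMF.map_bind, PMF.map_bind]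
  congr 1
  funext w'
  simp only [Function.comp_def]
  rw [exec_indexBlock]
  simp only [PMF.map_comp, Function.comp_def]

theorem exec_checkBlock (σ₂ σ : V.State) :
    exec (oracle z y) (checkBlock V h K)
      (memDecommitting σ₀ σ₁ e ok k σ₂ (decide ((V.opening σ₂).2 < I.v)) σ) =
      PMF.pure ([], memDecommitting σ₀ σ₁ e ok k σ₂
        (decide (∃ hl : (V.opening σ₂).2 < I.v, z ⟨(V.opening σ₂).2, hl⟩ = (V.opening σ₂).1)) σ) := by
  have hgen : ∀ (js : List (Fin I.m)) (b : Bool),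
      js.foldl (fun (μ : Mem V h K) j => { μ with
        opened := μ.opened &&
          decide (oracle z y (pos (openingAddress I (V.opening μ.afterCommit).2 j)) =
            (V.opening μ.afterCommit).1 j) }) (memDecommitting σ₀ σ₁ e ok k σ₂ b σ) =
      memDecommitting σ₀ σ₁ e ok k σ₂ (b && decide (∀ j ∈ js,
        oracle z y (pos (openingAddress I (V.opening σ₂).2 j)) = (V.opening σ₂).1 j)) σ :=
    fun js => by
      induction js with
      | nil => intro b; simp
      | cons j js ih =>
        intro b
        rw [List.foldl_cons]
        refine (ih _).trans ?_
        congr 1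
        simp only [memDecommitting, Bool.and_assoc, List.forall_mem_cons, Bool.decide_and]
        congr!
  rw [checkBlock, exec_queries, List.foldl_map, hgen]
  congr 3
  by_cases hl : (V.opening σ₂).2 < I.v
  · simp [hl, openingAddress, funext_iff]
  · simp [hl]

theorem exec_evaluationBlock (σ₂ : V.State) (opened : Bool) (j : Fin (I.d * I.m + 1))
    (σ : V.State) :
    exec (oracle z y) (evaluationBlock V h K j) (memDecommitting σ₀ σ₁ e ok k σ₂ opened σ) =
      (PMF.uniformOfFintype V.Coin).map fun c =>
        ([(.prover (.evaluation (∑ ij, weight V ok opened σ₁ σ₂ k (I.node j) ij * y ij.1 ij.2)), c)],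
          memDecommitting σ₀ σ₁ e ok k σ₂ opened (V.step σ (.prover (.evaluation
            (∑ ij, weight V ok opened σ₁ σ₂ k (I.node j) ij * y ij.1 ij.2))) c)) := by
  have hgen : ∀ (l : List (Fin (I.d * I.m) × Fin I.p)) (μ : Mem V h K),
      l.foldl (fun (μ : Mem V h K) ij => { μ with
        acc := μ.acc +
          weight V μ.ok μ.opened μ.afterInput μ.afterCommit μ.index (I.node j) ij *
            y ij.1 ij.2 }) μ =
      { μ with
        acc := μ.acc + (l.map fun ij => weight V μ.ok μ.opened μ.afterInput μ.afterCommit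
          μ.index (I.node j) ij * y ij.1 ij.2).sum } := fun l => by
    induction l with
    | nil => intro μ; simp
    | cons a l ih =>
      intro μ
      rw [List.foldl_cons, ih]
      simp [add_assoc]
  rw [evaluationBlock, exec_queries_append, exec_say, List.foldl_map]
  simp only [oracle_inr]
  rw [hgen]
  simp only [Finset.sum_map_toList, memDecommitting, memRead, zero_add]

/-- Each value of the last message is a linear form in the entries of `y`, with coefficients
computable from the stored states. One accumulator and a new pass over the random string therefore
suffice. -/
theorem algebraicDecommitment_eq_map (β : I.Pt) (σ₂ : V.State) :
    algebraicDecommitment I β z (V.line σ₁) y k (V.opening σ₂) (V.line' σ₂) =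
      (List.finRange (I.d * I.m + 1)).map fun (j : Fin (I.d * I.m + 1)) =>
        Letter.prover (.evaluation (∑ ij, weight V (decide ((V.line σ₁).1 = β)) (decide (∃ hl : (V.opening σ₂).2 < I.v,
          z ⟨(V.opening σ₂).2, hl⟩ = (V.opening σ₂).1)) σ₁ σ₂ k (I.node j) ij * y ij.1 ij.2)) := by
  set opened : Bool := decide (∃ hl : (V.opening σ₂).2 < I.v,
    z ⟨(V.opening σ₂).2, hl⟩ = (V.opening σ₂).1) with hopened
  by_cases hβ : (V.line σ₁).1 = β
  swap
  · rw [algebraicDecommitment, dif_neg fun H => hβ H.1]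
    rw [decommitMessage, List.ofFn_eq_map]
    exact List.map_congr_left fun j _ => by simp [weight, hβ]
  have ht : OpensAtOption z (V.line σ₁) (V.opening σ₂)
      (openedAt opened (V.line σ₁) (V.opening σ₂).1) := by
    unfold openedAt
    split_ifs with H
    · exact ⟨of_decide_eq_true H.1, H.2.choose_spec⟩
    · rintro ⟨t, h1, h2⟩
      exact H ⟨decide_eq_true h1, t, h2⟩
  rw [algebraicDecommitment_eq hβ y k (V.line' σ₂) ht]
  simp only [weight, hβ, decide_true, if_true]
  cases openedAt opened (V.line σ₁) (V.opening σ₂).1 with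
  | none =>
    rw [decommitAt, decommitMessage, List.ofFn_eq_map]
    exact List.map_congr_left fun j _ => by simp
  | some t =>
    by_cases hk : (V.line' σ₂).1 = I.coord k
    · simp only [decommitAt, hk, if_true, decommitMessage, List.ofFn_eq_map, sum_chi_mul_lde]
      congr! 4
      rw [Fintype.sum_prod_type_right]
      refine Finset.sum_congr rfl fun k' _ => ?_
      rw [Finset.sum_mul]
      exact Finset.sum_congr rfl fun i _ => by ring
    · rw [decommitAt, if_neg hk, decommitMessage, List.ofFn_eq_map]
      exact List.map_congr_left fun j _ => by simp [hk]

theorem exec_opsDecommit (β : I.Pt) (σ₂ : V.State) :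
    (exec (oracle z y) (opsDecommit V h K) (memDecommitting σ₀ σ₁ e (decide ((V.line σ₁).1 = β)) k
      σ₂ (decide ((V.opening σ₂).2 < I.v)) σ₂)).map (fun w => w.1) =
      (V.deliver (algebraicDecommitment I β z (V.line σ₁) y k (V.opening σ₂) (V.line' σ₂))
        σ₂).map fun w => w.1 := by
  rw [opsDecommit, exec_append, exec_checkBlock, PMF.pure_bind, algebraicDecommitment_eq_map,
    exec_flatMap _ V (evaluationBlock V h K) _ _ (exec_evaluationBlock z y σ₀ σ₁ e _ k σ₂ _)]
  simp only [PMF.map_comp, Function.comp_def, List.nil_append]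

theorem run_simulator (x : Fin I.n → I.Γ) (β : I.Pt) :
    (simulator pts ev).run (oracle z y) (simulator pts ev).time (simulator pts ev).init
      (inputStream I x β) =
      (V.deliver (setupMessage I z) V.init).bind fun w₀ =>
      (PMF.uniformOfFintype (Fin I.p)).bind fun k =>
      (V.deliver (inputStream I x β) w₀.2).bind fun w₁ =>
      (V.deliver (commitWith I β (V.line w₁.2)
        (simValues pts ev w₀.2 (finalEvals pts ev w₀.2 x) w₁.2) y k) w₁.2).bind fun w₂ =>
      (V.deliver (algebraicDecommitment I β z (V.line w₁.2) y k (V.opening w₂.2)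
        (V.line' w₂.2)) w₂.2).map fun w₃ => w₀.1 ++ w₁.1 ++ w₂.1 ++ w₃.1 := by
  have h1 : inputStream I x β = (List.ofFn x).map Letter.symbol ++ [Letter.point β] := by
    simp [inputStream, List.map_ofFn, Function.comp_def]
  have hrun := run_machine (readStep pts ev) (mem₀ pts ev)
    ((opsBefore pts ev).length + (I.n + 1 + (opsCommit pts ev ++ opsDecommit V h K).length))
    (oracle z y) (opsBefore pts ev) (opsCommit pts ev ++ opsDecommit V h K) (List.ofFn x) β
  rw [← h1, List.length_ofFn] at hrun
  refine hrun.trans ?_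
  rw [exec_opsBefore, PMF.bind_bind]
  congr 1
  funext w₀
  rw [PMF.bind_map]
  congr 1
  funext k
  simp only [Function.comp_def]
  rw [readInput_inputStream, PMF.bind_map]
  congr 1
  funext w₁
  simp only [Function.comp_def]
  rw [exec_append, exec_opsCommit, PMF.bind_map, PMF.map_bind]
  congr 1
  funext w₂
  have h2 := congrArg (PMF.map fun u => w₀.1 ++ w₁.1 ++ w₂.1 ++ u)
    (exec_opsDecommit z y w₀.2 w₁.2 (finalEvals pts ev w₀.2 x) k β w₂.2)
  simp only [PMF.map_comp, Function.comp_def, List.append_assoc] at h2 ⊢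
  exact h2

/-- Random strings are pairs of `z` and `y`. -/
def oracleEquiv (I : PEP) :
    (Fin I.v → I.Pt) × I.Mat ≃ (Fin (Fintype.card (Address I)) → I.F) where
  toFun s := oracle s.1 s.2
  invFun t := (fun i j => t (pos (.inl (i, j))), fun i j => t (pos (.inr (i, j))))
  left_inv s := by simp
  right_inv t := by
    funext a
    obtain ⟨b, rfl⟩ := pos.surjective a
    cases b <;> simp

/-- The simulation is exact apart from the committed values: `z`, `y` and `k` have the honest
distribution, and the verifier's messages come from its own states. -/
theorem simulatedView_simulator (x : Fin I.n → I.Γ) (β : I.Pt) :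
    simulatedView I (simulator pts ev) x β = viewWith I V x β fun σ₀ σ₁ =>
      simulatedValues I (pts σ₀) (fun j => MvPolynomial.eval (pts σ₀ j) (I.f x)) (V.line σ₁) := by
  have hval : ∀ σ₀ σ₁, simValues pts ev σ₀ (finalEvals pts ev σ₀ x) σ₁ =
      simulatedValues I (pts σ₀) (fun j => MvPolynomial.eval (pts σ₀ j) (I.f x)) (V.line σ₁) :=
    fun σ₀ σ₁ => by simp only [simValues, finalEvals, Evaluator.out_foldl]
  have h1 : simulatedView I (simulator pts ev) x β =
      (PMF.uniformOfFintype (Fin (Fintype.card (Address I)) → I.F)).bind fun t =>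
        (simulator pts ev).run t (simulator pts ev).time (simulator pts ev).init
          (inputStream I x β) := by
    unfold simulatedView
    congr!
    rename_i ht
    exact congrArg _ (eq_of_heq ht)
  rw [h1, ← uniform_map_equiv (oracleEquiv I), PMF.bind_map, uniform_prod, PMF.bind_bind, viewWith]
  congr 1
  funext z
  rw [PMF.bind_map]
  simp only [Function.comp_def]
  have h2 : ∀ y, oracleEquiv I (z, y) = oracle z y := fun _ => rfl
  simp only [h2, run_simulator, hval]
  -- The simulator has `y` from the start and `k` before the input; by independence they may be
  -- sampled where the prover samples them.
  rw [PMF.bind_comm]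
  congr 1
  funext w₀
  rw [uniform_prod]
  simp only [PMF.bind_bind, PMF.bind_map, Function.comp_def]
  rw [PMF.bind_comm (V.deliver (inputStream I x β) w₀.2)]
  congr 1
  funext y
  rw [PMF.bind_comm]

end Simulation

/-! ### The space of the simulator -/

section Space

variable {I : PEP}

theorem d_mul_m_lt_q : I.d * I.m < I.q := I.dm_lt

theorem m_lt_q : I.m < I.q :=
  lt_of_le_of_lt (Nat.le_mul_of_pos_left _ I.d_pos) d_mul_m_lt_q

theorem q_pos : 0 < I.q := lt_of_lt_of_le two_pos q_ge_two

theorem one_le_logq : 1 ≤ I.logq := by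
  have h : Real.logb 2 2 ≤ Real.logb 2 I.q :=
    Real.logb_le_logb_of_le one_lt_two two_pos (by exact_mod_cast q_ge_two)
  rwa [Real.logb_self_eq_one one_lt_two] at h

theorem logb_le_mul_logq {a k : ℕ} (ha : 0 < a) (h : a ≤ I.q ^ k) :
    Real.logb 2 a ≤ k * I.logq := by
  have h2 : Real.logb 2 a ≤ Real.logb 2 ((I.q : ℝ) ^ k) :=
    Real.logb_le_logb_of_le one_lt_two (by exact_mod_cast ha) (by exact_mod_cast h)
  rwa [Real.logb_pow] at h2

theorem logb_natCast_le (a : ℕ) : Real.logb 2 a ≤ a := by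
  rcases Nat.eq_zero_or_pos a with rfl | ha
  · simp
  · rw [Real.logb_le_iff_le_rpow one_lt_two (by exact_mod_cast ha), Real.rpow_natCast]
    exact_mod_cast Nat.lt_two_pow_self.le

theorem p_le_pow : I.p ≤ I.q ^ 7 := by
  calc I.p = I.m * (I.d * I.m * I.q) ^ 3 := rfl
    _ ≤ I.q * (I.q * I.q) ^ 3 := by
        gcongr
        · exact m_lt_q.le
        · exact d_mul_m_lt_q.le
    _ = I.q ^ 7 := by ring

theorem v_le_pow : I.v ≤ I.q ^ (I.m + 1) := by
  have hq : (2 : ℝ) ≤ I.q := by exact_mod_cast q_ge_two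
  have hqm : (1 : ℝ) ≤ (I.q : ℝ) ^ I.m := one_le_pow₀ (by linarith)
  have h1 : Real.logb 2 I.m ≤ I.q :=
    (logb_natCast_le _).trans (by exact_mod_cast m_lt_q.le)
  have h2 : Real.logb 2 I.logq ≤ I.q := by
    refine le_trans ?_ (logb_natCast_le I.q)
    exact Real.logb_le_logb_of_le one_lt_two (by linarith [one_le_logq (I := I)])
      (logb_natCast_le I.q)
  rw [PEP.v, Int.toNat_le]
  have h3 := round_le_add_half
    ((I.q : ℝ) ^ I.m * (Real.logb 2 I.m + Real.logb 2 I.logq) / 32)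
  have h4 : (I.q : ℝ) ^ I.m * (Real.logb 2 I.m + Real.logb 2 I.logq) ≤
      (I.q : ℝ) ^ I.m * (I.q + I.q) := by gcongr
  have h5 : (2 : ℝ) ≤ (I.q : ℝ) ^ I.m * I.q := by nlinarith
  have h6 : ((round ((I.q : ℝ) ^ I.m * (Real.logb 2 I.m + Real.logb 2 I.logq) / 32) : ℤ) : ℝ) ≤
      (((I.q ^ (I.m + 1) : ℕ) : ℤ) : ℝ) := by
    push_cast
    rw [pow_succ]
    linarith
  exact_mod_cast h6

variable {V : Verifier I} {h K : ℕ}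

theorem length_queries (qs : List ((Mem V h K → Address I) × (Mem V h K → I.F → Mem V h K))) :
    (queries qs).length = qs.length := by simp [queries]

theorem length_flatMap_const {A B : Type*} (l : List A) (f : A → List B) (c : ℕ)
    (hf : ∀ a, (f a).length = c) : (l.flatMap f).length = l.length * c := by
  simp [List.length_flatMap, hf]

variable (pts : V.State → Fin h → I.Pt) (ev : ∀ ρ, Evaluator I ρ K)

theorem length_opsBefore : (opsBefore pts ev).length = I.v * (I.m + 1) + 1 := by
  rw [opsBefore, List.length_append, length_flatMap_const _ _ (I.m + 1)]
  · simp
  · simp [setupBlock, length_queries]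

theorem length_opsCommit : (opsCommit pts ev).length =
    I.d * I.m * I.p * 2 + (I.d * I.m * 2 + 1) := by
  rw [opsCommit, List.length_append, List.length_append, length_flatMap_const _ _ 2,
    length_flatMap_const _ _ 2]
  · simp only [List.length_finRange, indexBlock, List.length_cons, List.length_nil, zero_add]
    rw [List.length_product, List.length_finRange, List.length_finRange]
  · simp [correctionBlock, length_queries]
  · simp [entryBlock, length_queries]

theorem length_opsDecommit : (opsDecommit V h K).length =
    I.m + (I.d * I.m + 1) * (I.d * I.m * I.p + 1) := by
  rw [opsDecommit, List.length_append, length_flatMap_const _ _ (I.d * I.m * I.p + 1)]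
  · simp [checkBlock, length_queries]
  · simp [evaluationBlock, length_queries]

/-- The first factor counts program positions. The second consists of four verifier states, h
evaluators, two Booleans, the index, the buffer (q^m) and the accumulator (q). -/
theorem card_state_simulator : Fintype.card (simulator pts ev).State =
    (I.v * (I.m + 1) + (I.d * I.m * I.p * 2 + (I.d * I.m * 2 + 1) +
      (I.m + (I.d * I.m + 1) * (I.d * I.m * I.p + 1))) + 3) *
    (Fintype.card V.State ^ 4 * K ^ h * 4 * I.p * I.q ^ (I.m + 1)) := by
  have h1 : Fintype.card (simulator pts ev).State = (((opsBefore pts ev).map some ++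
      none :: (opsCommit pts ev ++ opsDecommit V h K).map some).length + 1) *
      Fintype.card (Mem V h K) := by
    rw [← Fintype.card_fin ((((opsBefore pts ev).map some ++
      none :: (opsCommit pts ev ++ opsDecommit V h K).map some).length + 1)), ← Fintype.card_prod]
    rfl
  rw [h1, Fintype.card_congr (memEquiv V h K)]
  simp only [List.length_append, List.length_cons, List.length_map, length_opsBefore,
    length_opsCommit, length_opsDecommit, Fintype.card_prod, Fintype.card_fun, Fintype.card_fin,
    Fintype.card_bool, PEP.q]
  ring

theorem time_le_pow : I.v * (I.m + 1) + (I.d * I.m * I.p * 2 + (I.d * I.m * 2 + 1) +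
      (I.m + (I.d * I.m + 1) * (I.d * I.m * I.p + 1))) + 3 ≤ I.q ^ (13 * I.m) := by
  have hq := q_ge_two (I := I)
  have hm := I.m_pos
  have hmq := m_lt_q (I := I)
  have hdm := d_mul_m_lt_q (I := I)
  have hp := p_le_pow (I := I)
  have hp0 : 0 < I.p := Nat.pos_of_ne_zero (NeZero.ne _)
  have mono : ∀ {a b}, a ≤ b → I.q ^ a ≤ I.q ^ b := fun hab => Nat.pow_le_pow_right q_pos hab
  set B := I.q ^ (I.m + 8) with hB
  have h1 : I.v * (I.m + 1) ≤ B := by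
    calc I.v * (I.m + 1) ≤ I.q ^ (I.m + 1) * I.q := Nat.mul_le_mul v_le_pow hmq
      _ = I.q ^ (I.m + 2) := by ring
      _ ≤ B := mono (by omega)
  have h2 : I.d * I.m * I.p ≤ B := by
    calc I.d * I.m * I.p ≤ I.q * I.q ^ 7 := Nat.mul_le_mul hdm.le hp
      _ = I.q ^ 8 := by ring
      _ ≤ B := mono (by omega)
  have h3 : I.q ≤ B := by
    calc I.q = I.q ^ 1 := (pow_one _).symm
      _ ≤ B := mono (by omega)
  have h4 : (I.d * I.m + 1) * (I.d * I.m * I.p + 1) ≤ B := by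
    calc (I.d * I.m + 1) * (I.d * I.m * I.p + 1) ≤ I.q * (I.q * I.p) := by
          refine Nat.mul_le_mul hdm ?_
          calc I.d * I.m * I.p + 1 ≤ (I.d * I.m + 1) * I.p := by rw [add_mul]; omega
            _ ≤ I.q * I.p := Nat.mul_le_mul_right _ hdm
      _ ≤ I.q * (I.q * I.q ^ 7) := by gcongr
      _ = I.q ^ 9 := by ring
      _ ≤ B := mono (by omega)
  -- The constant 16 is absorbed by q⁴, and m + 12 ≤ 13m since m ≥ 1.
  have h5 : 16 * B ≤ I.q ^ (13 * I.m) := by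
    calc 16 * B ≤ I.q ^ 4 * B := Nat.mul_le_mul_right _
          (le_trans (by norm_num : 16 ≤ 2 ^ 4) (Nat.pow_le_pow_left hq 4))
      _ = I.q ^ (4 + (I.m + 8)) := (pow_add _ _ _).symm
      _ ≤ I.q ^ (13 * I.m) := mono (by omega)
  omega

/-- In units of m log q, 24 = 13 + 7 + 2 + 2 for the program counter, the index k, the two Booleans,
and buffer with accumulator. The dominant term is that of the h ≤ 2 log q evaluators. -/
theorem space_simulator_le {cf cV h : ℕ} {V : Verifier I} (pts : V.State → Fin h → I.Pt)
    (ev : ∀ ρ, Evaluator I ρ (I.q ^ (cf * I.m))) (hh : (h : ℝ) ≤ 2 * I.logq)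
    (hV : V.space ≤ cV * (I.m * I.logq)) :
    (simulator pts ev).space ≤
      ((24 + 4 * cV + 2 * cf : ℕ) : ℝ) * ((I.d + I.m * I.logq) * (I.m * I.logq)) := by
  have hV0 : 0 < Fintype.card V.State := Fintype.card_pos_iff.2 ⟨V.init⟩
  have hp0 : 0 < I.p := Nat.pos_of_ne_zero (NeZero.ne _)
  have hq0 := q_pos (I := I)
  have hl := one_le_logq (I := I)
  have hm : (1 : ℝ) ≤ I.m := by exact_mod_cast I.m_pos
  have hd : (1 : ℝ) ≤ I.d := by exact_mod_cast I.d_pos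
  have e1 := logb_le_mul_logq (I := I) (by omega) (time_le_pow (I := I))
  have e2 := logb_le_mul_logq (I := I) hp0 p_le_pow
  have hne : ∀ {a : ℕ}, 0 < a → (a : ℝ) ≠ 0 := fun ha => by exact_mod_cast ha.ne'
  have hT : 0 < I.v * (I.m + 1) + (I.d * I.m * I.p * 2 + (I.d * I.m * 2 + 1) +
      (I.m + (I.d * I.m + 1) * (I.d * I.m * I.p + 1))) + 3 := by omega
  have hc := card_state_simulator pts ev
  generalize I.v * (I.m + 1) + (I.d * I.m * I.p * 2 + (I.d * I.m * 2 + 1) +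
      (I.m + (I.d * I.m + 1) * (I.d * I.m * I.p + 1))) + 3 = T at *
  have h4 : Real.logb 2 4 = 2 := by
    rw [show (4 : ℝ) = 2 ^ 2 by norm_num, Real.logb_pow, Real.logb_self_eq_one one_lt_two]
    norm_num
  have hspace : (simulator pts ev).space = Real.logb 2 T + (4 * V.space +
      h * (cf * I.m * I.logq) + 2 + Real.logb 2 I.p + (I.m + 1) * I.logq) := by
    rw [Simulator.space, hc, Nat.cast_mul, Real.logb_mul]
    · push_cast
      rw [Real.logb_mul, Real.logb_mul, Real.logb_mul, Real.logb_mul, Real.logb_pow, Real.logb_pow,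
        Real.logb_pow, Real.logb_pow, h4, Verifier.space, PEP.logq]
      · push_cast
        ring
      all_goals
        have := hne hV0
        have := hne hq0
        have := hne hp0
        positivity
    · exact hne hT
    · exact hne (by positivity)
  have hX : 1 ≤ I.m * I.logq := by nlinarith
  have hlX : I.logq ≤ I.m * I.logq := by nlinarith
  have hcV : (0 : ℝ) ≤ cV := Nat.cast_nonneg _
  have hcf : (0 : ℝ) ≤ cf := Nat.cast_nonneg _
  have h5 : (h : ℝ) * (cf * I.m * I.logq) ≤ 2 * cf * (I.m * I.logq) * (I.m * I.logq) := by
    calc (h : ℝ) * (cf * I.m * I.logq) ≤ (2 * (I.m * I.logq)) * (cf * I.m * I.logq) := by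
          gcongr
          linarith
      _ = _ := by ring
  push_cast at e1 e2 ⊢
  rw [hspace]
  set X : ℝ := I.m * I.logq with hXdef
  have h6 : (24 + 4 * cV : ℝ) * X ≤ (24 + 4 * cV) * ((I.d + X) * X) := by
    gcongr
    nlinarith
  have h7 : 2 * cf * X * X ≤ 2 * cf * ((I.d + X) * X) := by
    rw [mul_assoc]
    gcongr
    linarith
  linarith

end Space

/-! ### Simulation -/

section Main

variable {I : PEP}

/-- The number of openings for which the simulator is prepared. -/
def PEP.guesses (I : PEP) : ℕ := Nat.log 2 I.q + 1

theorem guesses_le : (I.guesses : ℝ) ≤ 2 * I.logq := by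
  have h1 : ((Nat.log 2 I.q : ℕ) : ℝ) ≤ I.logq := Real.natLog_le_logb _ _
  have h2 := one_le_logq (I := I)
  rw [PEP.guesses]
  push_cast
  linarith

theorem logq_le_guesses : I.logq ≤ I.guesses := by
  have h1 : I.q ≤ 2 ^ I.guesses := (Nat.lt_pow_succ_log_self one_lt_two _).le
  rw [PEP.logq, Real.logb_le_iff_le_rpow one_lt_two (by exact_mod_cast q_pos), Real.rpow_natCast]
  exact_mod_cast h1

/-- True and simulated values both satisfy the linear conditions imposed by f^x at the points of `H`
and by f^x(β) = α, hence have equal combinations at every expected opening. -/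
theorem exists_simulator {cf : ℕ} (hE : EvaluableInSpace I (cf * (I.m * I.logq)))
    (V : Verifier I) :
    ∃ S : Simulator I V.Coin,
      (∀ cV : ℕ, V.space ≤ cV * (I.m * I.logq) →
        S.space ≤ ((24 + 4 * cV + 2 * cf : ℕ) : ℝ) *
          ((I.d + I.m * I.logq) * (I.m * I.logq))) ∧
      ∀ (D : Distinguisher (Letter I × V.Coin)) (x : Fin I.n → I.Γ) (β : I.Pt),
        (x, β) ∈ I.language → ∀ {lam mu : ℝ}, 0 < lam → lam ≤ 1 → 0 < mu →
        (Real.exp mu - 1) * I.guesses ≤ (I.q : ℝ) ^ I.m →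
        |D.acceptProb (realView I V x β) - D.acceptProb (simulatedView I S x β)| ≤
          (I.q + 1) * (Real.log (Fintype.card (D.State × V.State)) / (lam * I.p) + lam) +
            (Real.log (Fintype.card V.State) + 1) / (mu * I.guesses) := by
  obtain ⟨H, hcard, hH⟩ := abs_acceptProb_viewWith_sub_le V I.guesses
  choose pts hpts using fun σ => exists_points I (H σ) (hcard σ)
  have ev : ∀ ρ, Evaluator I ρ (I.q ^ (cf * I.m)) := fun ρ => (nonempty_evaluator hE ρ).some
  refine ⟨simulator pts ev, fun cV hV => space_simulator_le pts ev guesses_le hV,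
    fun D x β hx lam mu h0 h1 hmu hq => ?_⟩
  rw [realView_eq_viewWith, simulatedView_simulator]
  refine hH D x β _ _ (fun σ₀ σ₁ hL _ t l hl => ?_) h0 h1 hmu (Nat.succ_pos _) hq
  obtain ⟨j, hj⟩ := hpts σ₀ _ hl
  rw [consistent_lineValues I (pts σ₀) hx hL j t hj.symm,
    consistent_simulatedValues I (pts σ₀) hx hL j t hj.symm]

/-! ### Error estimates for the chosen parameters. -/

theorem log_natCast_le_logb (a : ℕ) : Real.log a ≤ Real.logb 2 a := by
  rcases Nat.eq_zero_or_pos a with rfl | ha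
  · simp
  · rw [Real.logb, le_div_iff₀ (Real.log_pos one_lt_two)]
    have h1 : Real.log 2 ≤ 1 := by linarith [Real.log_two_lt_d9]
    exact mul_le_of_le_one_right (Real.log_nonneg (by exact_mod_cast ha)) h1

/-- For λ = 1/((q + 1) log q) the summands λ contribute 1/log q in total. The rest is (q + 1)² log q
· s/p, and p ≥ (dm)²q³ absorbs both (q + 1)² and the factor (dm)² of the distinguisher's space. -/
theorem hiding_error_le {a e cV : ℕ} {s : ℝ} (hs : s ≤ a * (((I.d : ℝ) * I.m) ^ 2 * I.logq ^ e) +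
      cV * (I.m * I.logq)) :
    (I.q + 1) * (s / (1 / ((I.q + 1) * I.logq) * I.p) + 1 / ((I.q + 1) * I.logq)) ≤
      4 * (a + cV) * (I.logq ^ (e + 2) / I.q) + 1 / I.logq := by
  have hl := one_le_logq (I := I)
  have hl0 : 0 < I.logq := by linarith
  have hm : (1 : ℝ) ≤ I.m := by exact_mod_cast I.m_pos
  have hd : (1 : ℝ) ≤ I.d := by exact_mod_cast I.d_pos
  have hq : (1 : ℝ) ≤ I.q := by exact_mod_cast q_pos
  have hp : ((I.d : ℝ) * I.m) ^ 2 * (I.q : ℝ) ^ 3 ≤ I.p := by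
    have : (I.p : ℝ) = I.m * ((I.d : ℝ) * I.m * I.q) ^ 3 := by
      rw [PEP.p]
      push_cast
      ring
    rw [this, mul_pow _ (I.q : ℝ), ← mul_assoc]
    gcongr
    calc ((I.d : ℝ) * I.m) ^ 2 ≤ ((I.d : ℝ) * I.m) ^ 3 :=
          pow_le_pow_right₀ (by nlinarith) (by norm_num)
      _ ≤ I.m * ((I.d : ℝ) * I.m) ^ 3 := le_mul_of_one_le_left (by positivity) hm
  have hs' : s ≤ (a + cV) * (((I.d : ℝ) * I.m) ^ 2 * I.logq ^ (e + 1)) := by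
    refine hs.trans ?_
    rw [add_mul]
    have hdm : (I.m : ℝ) ≤ I.d * I.m := le_mul_of_one_le_left (by positivity) hd
    gcongr
    · omega
    · exact hdm.trans (le_self_pow₀ (hm.trans hdm) two_ne_zero)
    · calc I.logq = I.logq ^ 1 := (pow_one _).symm
        _ ≤ I.logq ^ (e + 1) := pow_le_pow_right₀ hl (by omega)
  have hp0 : (0 : ℝ) < ((I.d : ℝ) * I.m) ^ 2 * (I.q : ℝ) ^ 3 := by positivity
  have hpp : (0 : ℝ) < I.p := hp0.trans_le hp
  have h1 : (I.q + 1) * (s / (1 / ((I.q + 1) * I.logq) * I.p) + 1 / ((I.q + 1) * I.logq)) =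
      (I.q + 1) ^ 2 * I.logq * (s / I.p) + 1 / I.logq := by
    field_simp
  rw [h1]
  refine add_le_add ?_ le_rfl
  have h2 : s / I.p ≤ (a + cV) * (((I.d : ℝ) * I.m) ^ 2 * I.logq ^ (e + 1)) /
      (((I.d : ℝ) * I.m) ^ 2 * (I.q : ℝ) ^ 3) := by
    calc s / I.p ≤ (a + cV) * (((I.d : ℝ) * I.m) ^ 2 * I.logq ^ (e + 1)) / I.p := by gcongr
      _ ≤ _ := by gcongr
  calc (I.q + 1) ^ 2 * I.logq * (s / I.p)
      ≤ (I.q + I.q) ^ 2 * I.logq * ((a + cV) * (((I.d : ℝ) * I.m) ^ 2 * I.logq ^ (e + 1)) /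
        (((I.d : ℝ) * I.m) ^ 2 * (I.q : ℝ) ^ 3)) := by
        refine (mul_le_mul_of_nonneg_left h2 (by positivity)).trans
          (mul_le_mul_of_nonneg_right ?_ (by positivity))
        gcongr
    _ = 4 * (a + cV) * (I.logq ^ (e + 2) / I.q) := by
        field_simp
        ring

/-- For μ = m ln(q)/2 the ratio of the verifier's space to μ is bounded, so the number of guesses,
at least log q, is what makes the error vanish. -/
theorem binding_error_le {cV : ℕ} {s : ℝ} (hs : s ≤ cV * (I.m * I.logq)) :
    (s + 1) / (I.m * Real.log I.q / 2 * I.guesses) ≤ 4 * (cV + 1) * (1 / I.logq) := by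
  have hl := one_le_logq (I := I)
  have hm : (1 : ℝ) ≤ I.m := by exact_mod_cast I.m_pos
  have hX : 1 ≤ I.m * I.logq := by nlinarith
  have hlog : I.logq / 2 ≤ Real.log I.q := by
    have h2 : (1 / 2 : ℝ) ≤ Real.log 2 := by linarith [Real.log_two_gt_d9]
    have h3 : Real.log I.q = I.logq * Real.log 2 := by
      rw [PEP.logq, Real.logb, div_mul_cancel₀ _ (Real.log_pos one_lt_two).ne']
    rw [h3]
    nlinarith
  have hden : I.m * I.logq / 4 * I.logq ≤ I.m * Real.log I.q / 2 * I.guesses := by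
    have h4 : I.m * I.logq / 4 ≤ I.m * Real.log I.q / 2 := by nlinarith
    exact mul_le_mul h4 logq_le_guesses (by linarith) (le_trans (by positivity) h4)
  have hden0 : 0 < I.m * I.logq / 4 * I.logq := by positivity
  calc (s + 1) / (I.m * Real.log I.q / 2 * I.guesses)
      ≤ ((cV + 1) * (I.m * I.logq)) / (I.m * Real.log I.q / 2 * I.guesses) := by
        have := hden0.trans_le hden
        gcongr
        linarith
    _ ≤ ((cV + 1) * (I.m * I.logq)) / (I.m * I.logq / 4 * I.logq) := by gcongr
    _ = _ := by
        field_simp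

/-- Here exp(μ) = q^{m/2}, and the number of guesses is at most 2 log q ≤ q^{1/2} ≤ q^{m/2}. -/
theorem exp_mul_guesses_le (h : 4 * I.logq ^ 2 ≤ I.q) :
    (Real.exp (I.m * Real.log I.q / 2) - 1) * I.guesses ≤ (I.q : ℝ) ^ I.m := by
  have hq : (1 : ℝ) ≤ I.q := by exact_mod_cast q_pos
  set E := Real.exp (I.m * Real.log I.q / 2) with hE
  have hE2 : E * E = (I.q : ℝ) ^ I.m := by
    rw [hE, ← Real.exp_add, add_halves, ← Real.log_pow, Real.exp_log (by positivity)]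
  have hE0 : 0 < E := Real.exp_pos _
  have hg : (I.guesses : ℝ) ≤ E := by
    refine le_of_sq_le_sq ?_ hE0.le
    rw [sq E, hE2]
    calc (I.guesses : ℝ) ^ 2 ≤ (2 * I.logq) ^ 2 := by
          gcongr
          exact guesses_le
      _ = 4 * I.logq ^ 2 := by ring
      _ ≤ I.q := h
      _ ≤ (I.q : ℝ) ^ I.m := le_self_pow₀ hq I.m_pos.ne'
  calc (E - 1) * I.guesses ≤ E * E := by
        gcongr
        linarith
    _ = _ := hE2

theorem tendsto_logb_pow_div (k : ℕ) :
    Tendsto (fun x : ℝ => Real.logb 2 x ^ k / x) atTop (𝓝 0) := by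
  have h := (Real.isLittleO_pow_log_id_atTop (n := k)).tendsto_div_nhds_zero
  have h2 := h.const_mul ((Real.log 2 ^ k)⁻¹)
  rw [mul_zero] at h2
  refine h2.congr fun x => ?_
  simp only [Real.logb, div_pow, id]
  ring

theorem tendsto_inv_logb : Tendsto (fun x : ℝ => 1 / Real.logb 2 x) atTop (𝓝 0) :=
  (Real.tendsto_logb_atTop one_lt_two).const_div_atTop 1

end Main

end ZKPep

end

theorem mainTheorem1 :
    ∀ cf cV : ℕ, ∃ cS : ℕ, ∀ I : ℕ → ZKPep.PEP,
      Tendsto (fun i => (I i).q) atTop atTop →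
      Tendsto (fun i => ((I i).d * (I i).m : ℝ) / (I i).q) atTop (𝓝 0) →
      (∀ i, ZKPep.EvaluableInSpace (I i) (cf * ((I i).m * (I i).logq))) →
      ∃ S : (i : ℕ) → (V : ZKPep.Verifier (I i)) → ZKPep.Simulator (I i) V.Coin,
        (∀ i (V : ZKPep.Verifier (I i)), V.space ≤ cV * ((I i).m * (I i).logq) →
          (S i V).space ≤
            cS * (((I i).d + (I i).m * (I i).logq) * ((I i).m * (I i).logq))) ∧
        ∀ V : (i : ℕ) → ZKPep.Verifier (I i),
          (∀ i, (V i).space ≤ cV * ((I i).m * (I i).logq)) →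
          ∀ (a e : ℕ) (D : (i : ℕ) → ZKPep.Distinguisher (ZKPep.Letter (I i) × (V i).Coin)),
            (∀ i, (D i).space ≤ a * (((I i).d * (I i).m : ℝ) ^ 2 * (I i).logq ^ e)) →
            ∀ (x : (i : ℕ) → Fin (I i).n → (I i).Γ) (β : (i : ℕ) → (I i).Pt),
              (∀ i, (x i, β i) ∈ (I i).language) →
              Tendsto
                (fun i =>
                  |(D i).acceptProb (ZKPep.realView (I i) (V i) (x i) (β i)) -
                    (D i).acceptProb (ZKPep.simulatedView (I i) (S i (V i)) (x i) (β i))|)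
                atTop (𝓝 0) := by
  intro cf cV
  refine ⟨24 + 4 * cV + 2 * cf, fun I hq _ hE => ?_⟩
  choose S hspace hS using fun i V => ZKPep.exists_simulator (hE i) V
  refine ⟨S, fun i V => hspace i V cV, fun V hV a e D hD x β hx => ?_⟩
  have hqr : Tendsto (fun i => ((I i).q : ℝ)) atTop atTop :=
    tendsto_natCast_atTop_atTop.comp hq
  have hinv := ZKPep.tendsto_inv_logb.comp hqr
  have hlim := (((ZKPep.tendsto_logb_pow_div (e + 2)).comp hqr).const_mul
    (4 * ((a : ℝ) + cV))).add hinv |>.add (hinv.const_mul (4 * ((cV : ℝ) + 1)))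
  simp only [mul_zero, add_zero] at hlim
  refine squeeze_zero' (Eventually.of_forall fun i => abs_nonneg _) ?_ hlim
  -- The bound 1/4 yields 4 log² q ≤ q for large q, the hypothesis of `exp_mul_guesses_le`.
  have hev := ((ZKPep.tendsto_logb_pow_div 2).comp hqr).eventually
    (gt_mem_nhds (show (0 : ℝ) < 1 / 4 by norm_num))
  filter_upwards [hev] with i hi
  have hl := ZKPep.one_le_logq (I := I i)
  have hq0 : (0 : ℝ) < (I i).q := by exact_mod_cast ZKPep.q_pos
  have hm0 : (0 : ℝ) < (I i).m := by exact_mod_cast (I i).m_pos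
  have h4 : 4 * (I i).logq ^ 2 ≤ (I i).q := by
    have h5 : (I i).logq ^ 2 / (I i).q < 1 / 4 := hi
    rw [div_lt_iff₀ hq0] at h5
    linarith
  have hlogq : 0 < Real.log (I i).q :=
    Real.log_pos (by exact_mod_cast ZKPep.q_ge_two (I := I i))
  have hD0 : (Fintype.card (D i).State : ℝ) ≠ 0 := by
    exact_mod_cast (Fintype.card_pos_iff.2 ⟨(D i).init⟩).ne'
  have hV0 : (Fintype.card (V i).State : ℝ) ≠ 0 := by
    exact_mod_cast (Fintype.card_pos_iff.2 ⟨(V i).init⟩).ne'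
  have hbound := hS i (V i) (D i) (x i) (β i) (hx i)
    -- λ is small enough to survive the factor q + 1; μ is of order m log q, as large as the
    -- verifier's space up to a constant, with exp(μ) only the square root of the number of points.
    (lam := 1 / (((I i).q + 1) * (I i).logq)) (mu := (I i).m * Real.log (I i).q / 2)
    (by positivity)
    (by
      rw [div_le_one (by positivity)]
      nlinarith)
    (by positivity) (ZKPep.exp_mul_guesses_le h4)
  refine hbound.trans (add_le_add (ZKPep.hiding_error_le ?_) (ZKPep.binding_error_le ?_))
  · rw [Fintype.card_prod, Nat.cast_mul, Real.log_mul hD0 hV0]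
    exact add_le_add ((ZKPep.log_natCast_le_logb _).trans (hD i))
      ((ZKPep.log_natCast_le_logb _).trans (hV i))
  · exact (ZKPep.log_natCast_le_logb _).trans (hV i)
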